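/- Let $X$ be a complex Banach space, $\mathcal B(X)$ the bounded operators on $X$ with operator norm $\|\cdot\|$, and $\mathcal F(X)$ the finite-rank operators. For $L\in\mathcal B(X)$ let $(\lambda_j(L))$ denote the discrete eigenvalues of $L$ (isolated eigenvalues of finite algebraic multiplicity), counted according to their algebraic multiplicity. For $F\in\mathcal F(X)$ with range $R$ and restriction $F_R:R\to R$ put $\det(I-F):=\det(I_R-F_R)$, $\operatorname{tr}(F):=\operatorname{tr}(F_R)$ and, for $p>0$, $$\det\nolimits_p(I-F):=\det(I-F)\exp\Big(\sum_{k=1}^{\lceil p\rceil-1}\frac1k\operatorname{tr}(F^k)\Big).$$ A quasi-norm on a complex vector space $V$, with quasi-triangle constant $q\ge 1$, is a map $\|\cdot\|_V:V\to[0,\infty)$ with $\|x\|_V=0\iff x=0$, $\|\lambda x\|_V=|\lambda|\|x\|_V$ and $\|x+y\|_V\le q(\|x\|_V+\|y\|_V)$; $V$ carries the topology in which the sets $\{y:\|y-x\|_V<\varepsilon\}$, $\varepsilon>0$, form a neighbourhood basis of $x$. Let $p>0$. An $l_p$-ideal in $\mathcal B(X)$ with eigenvalue constant $\gamma_p$ is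 a linear subspace $\mathcal I$ of $\mathcal B(X)$ with a quasi-norm $\|\cdot\|_{\mathcal I}$ such that: (A1) $\mathcal F(X)\subset\mathcal I$ is dense in $(\mathcal I,\|\cdot\|_{\mathcal I})$; (A2) $\|L\|\le\|L\|_{\mathcal I}$ for $L\in\mathcal I$; (A3) if $L\in\mathcal I$ and $A,B\in\mathcal B(X)$, then $ALB\in\mathcal I$ and $\|ALB\|_{\mathcal I}\le\|A\|\,\|L\|_{\mathcal I}\,\|B\|$; (A4) $\big(\sum_j|\lambda_j(L)|^p\big)^{1/p}\le\gamma_p\|L\|_{\mathcal I}$ for every $L\in\mathcal I$. **Theorem.** Let $p>0$. There is a constant $\Gamma_p>0$, depending only on $p$, such that for every complex Banach space $X$ $$|\det\nolimits_p(I-F)|\le\exp\Big(\Gamma_p\sum_k|\lambda_k(F)|^p\Big)\qquad(F\in\mathcal F(X)).\tag{1}$$ Let $(\mathcal I,\|\cdot\|_{\mathcal I})$ be an $l_p$-ideal in $\mathcal B(X)$ with quasi-triangle constant $q_{\mathcal I}$ and eigenvalue constant $\gamma_p$. Then there exists a unique continuous function $\det_{p,\mathcal I}(I-\,\cdot\,):(\mathcal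 I,\|\cdot\|_{\mathcal I})\to\mathbb C$ such that $\det_{p,\mathcal I}(I-F)=\det_p(I-F)$ for all $F\in\mathcal F(X)$. Moreover, for every constant $\Gamma_p>0$ that satisfies (1) on $X$ and for all $K,L\in\mathcal I$, $$|\det\nolimits_{p,\mathcal I}(I-L)|\le\exp\big(\gamma_p^p\,\Gamma_p\,\|L\|_{\mathcal I}^p\big)$$ and $$|\det\nolimits_{p,\mathcal I}(I-K)-\det\nolimits_{p,\mathcal I}(I-L)|\le\|K-L\|_{\mathcal I}\exp\Big(q_{\mathcal I}^{2p}\,\gamma_p^p\,\Gamma_p\,\big(\|K\|_{\mathcal I}+\|L\|_{\mathcal I}+1\big)^p\Big).$$ -/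

import Mathlib

open scoped ENNReal Topology

universe u

noncomputable section

/-! ### Finite rank operators, their determinant, trace and regularized determinant -/

section FiniteRank

variable {X : Type u} [NormedAddCommGroup X] [NormedSpace ℂ X]

/-- The range `Ran F`, as a linear subspace of `X`. -/
def opRange (F : X →L[ℂ] X) : Submodule ℂ X :=
  LinearMap.range (F : X →ₗ[ℂ] X)

/-- `F` has finite rank: its range is finite-dimensional. -/
def IsFiniteRank (F : X →L[ℂ] X) : Prop :=
  FiniteDimensional ℂ (opRange F)

/-- The restriction `F_R : R → R` of `F` to its (invariant) range `R = Ran F`. -/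
def restrictRange (F : X →L[ℂ] X) : opRange F →ₗ[ℂ] opRange F :=
  (F : X →ₗ[ℂ] X).restrict (p := opRange F) (q := opRange F)
    (fun x _ => LinearMap.mem_range_self (F : X →ₗ[ℂ] X) x)

/-- `det (I - F) = det (I_R - F_R)` for a finite rank operator `F` with range `R`. -/
def detOneSub (F : X →L[ℂ] X) : ℂ :=
  LinearMap.det (LinearMap.id - restrictRange F)

/-- `tr F = tr F_R` for a finite rank operator `F` with range `R`. -/
def finTrace (F : X →L[ℂ] X) : ℂ :=
  LinearMap.trace ℂ (opRange F) (restrictRange F)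

/-- The `p`-regularized determinant of `I - F` for a finite rank operator `F`:
`det (I - F) * exp (∑_{k=1}^{⌈p⌉-1} tr (F^k) / k)`. -/
def regDet (p : ℝ) (F : X →L[ℂ] X) : ℂ :=
  detOneSub F * Complex.exp (∑ k ∈ Finset.Ico 1 ⌈p⌉₊, (1 / (k : ℂ)) * finTrace (F ^ k))

end FiniteRank

/-! ### Discrete eigenvalues -/

section Eigenvalues

variable {X : Type u} [NormedAddCommGroup X] [NormedSpace ℂ X]

/-- The generalized eigenspace `⋃ k, ker (μ - L)^k`. For a compact operator `L` and `μ ≠ 0` in its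
spectrum this is the range of the Riesz projection of `L` at `μ`. -/
def genEigenspaceOf (L : X →L[ℂ] X) (μ : ℂ) : Submodule ℂ X :=
  Module.End.maxGenEigenspace (L : X →ₗ[ℂ] X) μ

/-- The discrete eigenvalues of `L`: the eigenvalues that are isolated points of the spectrum and
have finite algebraic multiplicity. (Whether `0` is included is immaterial for the sums below,
where it contributes `0`.) -/
def discreteSpectrum (L : X →L[ℂ] X) : Set ℂ :=
  {μ | Module.End.HasEigenvalue (L : X →ₗ[ℂ] X) μ ∧
    (∀ᶠ ν in 𝓝[≠] μ, ν ∉ spectrum ℂ L) ∧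
    FiniteDimensional ℂ (genEigenspaceOf L μ)}

/-- `∑ⱼ |λⱼ(L)|^p` in `[0, ∞]`, the sum being over all discrete eigenvalues of `L`, each counted
according to its algebraic multiplicity. -/
def eigenvalueSum (p : ℝ) (L : X →L[ℂ] X) : ℝ≥0∞ :=
  ∑' μ : discreteSpectrum L,
    (Module.finrank ℂ (genEigenspaceOf L (μ : ℂ)) : ℝ≥0∞) * ‖(μ : ℂ)‖ₑ ^ p

end Eigenvalues

/-- `Γ > 0` is an admissible constant in the estimate
`|det_p (I - F)| ≤ exp (Γ ∑ₖ |λₖ(F)|^p)` for all finite rank operators `F` on `X`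
(the sum on the right is finite). -/
def IsGrowthConstant (X : Type u) [NormedAddCommGroup X] [NormedSpace ℂ X] (p Γ : ℝ) : Prop :=
  0 < Γ ∧ ∀ F : X →L[ℂ] X, IsFiniteRank F →
    ‖regDet p F‖ ≤ Real.exp (Γ * (eigenvalueSum p F).toReal)

/-! ### Quasi-norms -/

section QuasiNorm

variable {V : Type u} [AddCommGroup V] [Module ℂ V]

/-- `N` is a quasi-norm on the complex vector space `V`, with quasi-triangle constant `q`. -/
structure IsQuasiNorm (N : V → ℝ) (q : ℝ) : Prop where
  nonneg : ∀ x, 0 ≤ N x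
  eq_zero_iff : ∀ x, N x = 0 ↔ x = 0
  one_le : 1 ≤ q
  add_le : ∀ x y, N (x + y) ≤ q * (N x + N y)
  smul_eq : ∀ (a : ℂ) (x : V), N (a • x) = ‖a‖ * N x

/-- The topology induced by a quasi-norm `N`: a set is open if with each of its points `x` it
contains some `{y | N (y - x) < ε}`, `ε > 0`. -/
@[reducible]
def quasiNormTopology (N : V → ℝ) : TopologicalSpace V where
  IsOpen U := ∀ x ∈ U, ∃ ε > 0, ∀ y, N (y - x) < ε → y ∈ U
  isOpen_univ := fun _ _ => ⟨1, one_pos, fun _ _ => Set.mem_univ _⟩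
  isOpen_inter := by
    intro s t hs ht x hx
    obtain ⟨a, ha, h1⟩ := hs x hx.1
    obtain ⟨b, hb, h2⟩ := ht x hx.2
    exact ⟨min a b, lt_min ha hb, fun y hy =>
      ⟨h1 y (lt_of_lt_of_le hy (min_le_left _ _)), h2 y (lt_of_lt_of_le hy (min_le_right _ _))⟩⟩
  isOpen_sUnion := by
    intro S hS x hx
    obtain ⟨t, ht, hxt⟩ := hx
    obtain ⟨a, ha, h1⟩ := hS t ht x hxt
    exact ⟨a, ha, fun y hy => ⟨t, ht, h1 y hy⟩⟩

/-- For a quasi-norm, the sets `{y | N (y - x) < ε}` form a basis of neighbourhoods of `x`. -/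
theorem mem_nhds_quasiNormTopology {N : V → ℝ} {q : ℝ} (hN : IsQuasiNorm N q) (x : V)
    (s : Set V) :
    s ∈ @nhds V (quasiNormTopology N) x ↔ ∃ ε > 0, ∀ y, N (y - x) < ε → y ∈ s := by
  let _ := quasiNormTopology N
  rw [mem_nhds_iff]
  constructor
  · rintro ⟨t, hts, ht, hx⟩
    obtain ⟨ε, hε, h⟩ := ht x hx
    exact ⟨ε, hε, fun y hy => hts (h y hy)⟩
  · rintro ⟨ε, hε, h⟩
    have hq : 0 < q := lt_of_lt_of_le one_pos hN.one_le
    refine ⟨{y | ∃ δ > 0, ∀ z, N (z - y) < δ → z ∈ s}, ?_, ?_, ⟨ε, hε, h⟩⟩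
    · rintro y ⟨δ, hδ, hy⟩
      exact hy y (by rw [sub_self, (hN.eq_zero_iff 0).2 rfl]; exact hδ)
    · rintro y ⟨δ, hδ, hy⟩
      refine ⟨δ / (2 * q), by positivity, fun z hz => ⟨δ / (2 * q), by positivity, fun v hv => ?_⟩⟩
      apply hy
      have h1 := hN.add_le (v - z) (z - y)
      rw [sub_add_sub_cancel] at h1
      refine lt_of_le_of_lt h1 ?_
      have h2 : q * (N (v - z) + N (z - y)) < q * (δ / (2 * q) + δ / (2 * q)) := by gcongr
      have h3 : q * (δ / (2 * q) + δ / (2 * q)) = δ := by field_simp; norm_num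
      linarith

end QuasiNorm

/-! ### `l_p`-ideals -/

/-- The subspace `𝓘` of `𝓑(X)`, with the quasi-norm `N` of quasi-triangle constant `q`, is an
`l_p`-ideal in `𝓑(X)` with eigenvalue constant `γ`. -/
structure IsLpIdeal {X : Type u} [NormedAddCommGroup X] [NormedSpace ℂ X]
    (p : ℝ) (𝓘 : Submodule ℂ (X →L[ℂ] X)) (N : 𝓘 → ℝ) (q γ : ℝ) : Prop where
  quasiNorm : IsQuasiNorm N q
  finiteRank_mem : ∀ F : X →L[ℂ] X, IsFiniteRank F → F ∈ 𝓘
  finiteRank_dense : @Dense 𝓘 (quasiNormTopology N) {L : 𝓘 | IsFiniteRank (L : X →L[ℂ] X)}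
  opNorm_le : ∀ L : 𝓘, ‖(L : X →L[ℂ] X)‖ ≤ N L
  mul_mem : ∀ (A B : X →L[ℂ] X) (L : 𝓘), A * (L : X →L[ℂ] X) * B ∈ 𝓘
  mul_le : ∀ (A B : X →L[ℂ] X) (L : 𝓘),
    N ⟨A * (L : X →L[ℂ] X) * B, mul_mem A B L⟩ ≤ ‖A‖ * N L * ‖B‖
  eigenvalue_le : ∀ L : 𝓘,
    eigenvalueSum p (L : X →L[ℂ] X) ^ (1 / p) ≤ ENNReal.ofReal (γ * N L)

/-- `D` is a continuous function on `(𝓘, N)` that extends `F ↦ det_p (I - F)` from the finite rank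
operators. -/
def IsContinuousDetExtension {X : Type u} [NormedAddCommGroup X] [NormedSpace ℂ X]
    (p : ℝ) (𝓘 : Submodule ℂ (X →L[ℂ] X)) (N : 𝓘 → ℝ) (D : 𝓘 → ℂ) : Prop :=
  Continuous[quasiNormTopology N, inferInstance] D ∧
    ∀ F : 𝓘, IsFiniteRank (F : X →L[ℂ] X) → D F = regDet p (F : X →L[ℂ] X)

end

/-!
Let `m = ⌈p⌉` and let `E_m` be the Weierstrass factor, so that `det_p (I - F) = ∏ E_m (λ_j (F))` for
`F` of finite rank. The bound `|E_m (u)| ≤ exp (Γ |u| ^ p)` gives the growth estimate for such `F`.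
As `det_p (I - ·)` is entire along lines, Cauchy's estimate makes it Lipschitz on bounded sets of
finite rank operators; hence it extends, and the extension is again entire along lines.

Passing to the limit in the growth estimate by means of the quasi-norm would cost a power of `q`.
Instead one passes to the limit in the eigenvalues. If `F → L`, the eigenvalues of modulus at least
`ρ` contribute at most `exp (Γ (∑ |λ_j (L)| ^ p + ε))`. The small ones contribute at most `exp ε`:
for `p < m` because `|E_m (u)| ≤ exp (2 |u| ^ m)`; for `p = m` because moreover the sum of their
`m`-th powers is small, as in Lindelöf's theorem. Indeed `z ↦ det_p (I - z F)` is of minimal type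
of order `m` uniformly in `F` near `L`, its product over the rotations of `z` by `m`-th roots of
unity is `∏ (1 - z ^ m λ_j ^ m)`, and the Borel-Carathéodory theorem bounds the linear coefficient
of the zero-free part.
-/

section LinearAlgebra

open Polynomial Module

variable {K V : Type*} [Field K] [AddCommGroup V] [Module K V]

theorem mapQ_aeval_mkQ {W : Submodule K V} {f : End K V} (hW : W ≤ W.comap f) (q : K[X]) (x : V) :
    aeval (W.mapQ W f hW) q (W.mkQ x) = W.mkQ (aeval f q x) := by
  induction q using Polynomial.induction_on' with
  | add p q hp hq => simp only [map_add, LinearMap.add_apply, hp, hq]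
  | monomial n a =>
    simp only [aeval_monomial, End.mul_apply, Module.algebraMap_end_apply, map_smul,
      ← W.mapQ_pow hW n, Submodule.mkQ_apply, Submodule.mapQ_apply]

theorem finrank_comap_mkQ [FiniteDimensional K V] (W : Submodule K V) (S : Submodule K (V ⧸ W)) :
    finrank K (S.comap W.mkQ) = finrank K S + finrank K W := by
  have hsurj : Function.Surjective
      (W.mkQ.restrict (p := S.comap W.mkQ) (q := S) fun _ hx => hx) := by
    rintro ⟨y, hy⟩
    obtain ⟨x, rfl⟩ := W.mkQ_surjective y
    exact ⟨⟨x, hy⟩, rfl⟩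
  have hle : W ≤ S.comap W.mkQ := fun x hx => by simp [(Submodule.Quotient.mk_eq_zero W).2 hx]
  have hker : LinearMap.ker (W.mkQ.restrict (p := S.comap W.mkQ) (q := S) fun _ hx => hx) =
      W.comap (S.comap W.mkQ).subtype := by
    ext x
    simp [← Subtype.coe_inj]
  have h := LinearMap.finrank_range_add_finrank_ker
    (W.mkQ.restrict (p := S.comap W.mkQ) (q := S) fun _ hx => hx)
  rw [LinearMap.range_eq_top.2 hsurj, finrank_top, hker,
    (Submodule.comapSubtypeEquivOfLe hle).finrank_eq] at h
  exact h.symm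

theorem charpoly_restrict_span_singleton {f : End K V} {μ : K} {v : V}
    (hv : f.HasEigenvector μ v) (hW : (K ∙ v) ≤ (K ∙ v).comap f) :
    (f.restrict hW).charpoly = X - C μ := by
  have hμ : End.HasEigenvector (f.restrict hW) μ ⟨v, Submodule.mem_span_singleton_self v⟩ :=
    ⟨End.mem_eigenspace_iff.2 (Subtype.ext hv.apply_eq_smul),
      fun h => hv.2 (congrArg Subtype.val h)⟩
  refine eq_of_monic_of_dvd_of_natDegree_le (monic_X_sub_C μ) (LinearMap.charpoly_monic _)
    (dvd_iff_isRoot.2 ((End.hasEigenvalue_iff_isRoot_charpoly _ μ).1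
      (End.hasEigenvalue_of_hasEigenvector hμ))) ?_
  rw [LinearMap.charpoly_natDegree, finrank_span_singleton hv.2, natDegree_X_sub_C]

variable [FiniteDimensional K V]

theorem charpoly_eq_charpoly_restrict_mul_charpoly_mapQ [Infinite K] {f : End K V}
    {W : Submodule K V} (hW : W ≤ W.comap f) :
    f.charpoly = (f.restrict hW).charpoly * (W.mapQ W f hW).charpoly := by
  refine Polynomial.funext fun t => ?_
  have ht : W ≤ W.comap (algebraMap K (End K V) t - f) := fun x hx =>
    W.sub_mem (W.smul_mem t hx) (hW hx)
  rw [eval_mul, LinearMap.eval_charpoly, LinearMap.eval_charpoly, LinearMap.eval_charpoly,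
    LinearMap.det_eq_det_mul_det W _ ht]
  congr 2
  ext x
  simp [Module.algebraMap_end_apply]

theorem card_le_finrank_ker_aeval [Infinite K] (t : Multiset K) (f : End K V)
    (ht : t ≤ f.charpoly.roots) :
    t.card ≤ finrank K (LinearMap.ker (aeval f (t.map fun a => X - C a).prod)) := by
  induction t using Multiset.induction generalizing V with
  | empty => exact Nat.zero_le _
  | cons μ t ih =>
    have hμ : μ ∈ f.charpoly.roots := Multiset.mem_of_le ht (Multiset.mem_cons_self μ t)
    obtain ⟨v, hv⟩ := ((End.hasEigenvalue_iff_isRoot_charpoly f μ).2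
      (isRoot_of_mem_roots hμ)).exists_hasEigenvector
    have hW : (K ∙ v) ≤ (K ∙ v).comap f := by
      rw [Submodule.span_singleton_le_iff_mem, Submodule.mem_comap, hv.apply_eq_smul]
      exact Submodule.smul_mem _ _ (Submodule.mem_span_singleton_self v)
    have hroots : f.charpoly.roots = μ ::ₘ ((K ∙ v).mapQ (K ∙ v) f hW).charpoly.roots := by
      rw [charpoly_eq_charpoly_restrict_mul_charpoly_mapQ hW, charpoly_restrict_span_singleton hv,
        roots_mul (mul_ne_zero (X_sub_C_ne_zero μ) (LinearMap.charpoly_monic _).ne_zero),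
        roots_X_sub_C, Multiset.singleton_add]
    rw [hroots, Multiset.cons_le_cons_iff] at ht
    set q := (t.map fun a => X - C a).prod with hq
    have hker : (LinearMap.ker (aeval ((K ∙ v).mapQ (K ∙ v) f hW) q)).comap (K ∙ v).mkQ ≤
        LinearMap.ker (aeval f ((μ ::ₘ t).map fun a => X - C a).prod) := by
      intro x hx
      rw [Submodule.mem_comap, LinearMap.mem_ker, mapQ_aeval_mkQ, Submodule.mkQ_apply,
        Submodule.Quotient.mk_eq_zero] at hx
      obtain ⟨a, ha⟩ := Submodule.mem_span_singleton.1 hx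
      rw [LinearMap.mem_ker, Multiset.map_cons, Multiset.prod_cons, map_mul, End.mul_apply, ← hq,
        ← ha]
      simp [hv.apply_eq_smul, Module.algebraMap_end_apply]
    calc (μ ::ₘ t).card = t.card + finrank K (K ∙ v) := by
          rw [Multiset.card_cons, finrank_span_singleton hv.2]
      _ ≤ finrank K (LinearMap.ker (aeval ((K ∙ v).mapQ (K ∙ v) f hW) q)) + finrank K (K ∙ v) :=
          Nat.add_le_add_right (ih _ ht) _
      _ ≤ _ := finrank_comap_mkQ (K ∙ v) _ ▸ Submodule.finrank_mono hker

theorem trace_restrict_maxGenEigenspace_pow (f : End K V) (μ : K)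
    (hf : Set.MapsTo f (f.maxGenEigenspace μ) (f.maxGenEigenspace μ)) (k : ℕ) :
    LinearMap.trace K _ (f.restrict hf ^ k) = f.charpoly.rootMultiplicity μ * μ ^ k := by
  induction k with
  | zero => rw [pow_zero, LinearMap.trace_one, LinearMap.finrank_maxGenEigenspace_eq, pow_zero,
      mul_one]
  | succ k ih =>
    rw [pow_succ, End.mul_eq_comp, LinearMap.trace_comp_eq_mul_of_commute_of_isNilpotent μ
      ((Commute.refl (f.restrict hf)).pow_left k)
      (f.isNilpotent_restrict_maxGenEigenspace_sub_algebraMap μ), ih]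
    ring

theorem trace_pow_eq_sum_roots_charpoly [IsAlgClosed K] (f : End K V) (k : ℕ) :
    LinearMap.trace K V (f ^ k) = (f.charpoly.roots.map (· ^ k)).sum := by
  classical
  have hds := DirectSum.isInternal_submodule_of_iSupIndep_of_iSup_eq_top
    f.independent_maxGenEigenspace (End.iSup_maxGenEigenspace_eq_top f)
  have hfin : {μ | f.maxGenEigenspace μ ≠ ⊥}.Finite :=
    WellFoundedGT.finite_ne_bot_of_iSupIndep f.independent_maxGenEigenspace
  have hmaps (μ : K) : Set.MapsTo f (f.maxGenEigenspace μ) (f.maxGenEigenspace μ) :=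
    f.mapsTo_maxGenEigenspace_of_comm (Commute.refl f) μ
  have hpow (μ : K) : Set.MapsTo (f ^ k) (f.maxGenEigenspace μ) (f.maxGenEigenspace μ) :=
    f.mapsTo_maxGenEigenspace_of_comm ((Commute.refl f).pow_right k) μ
  have htrace (μ : K) : LinearMap.trace K _ ((f ^ k).restrict (hpow μ)) =
      f.charpoly.rootMultiplicity μ * μ ^ k := by
    rw [← trace_restrict_maxGenEigenspace_pow f μ (hmaps μ)]
    exact congrArg _ (End.pow_restrict k (hmaps μ)).symm
  rw [LinearMap.trace_eq_sum_trace_restrict' hds hfin hpow, Finset.sum_multiset_map_count]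
  simp_rw [htrace, count_roots, nsmul_eq_mul]
  refine (Finset.sum_subset (fun μ hμ => ?_) fun μ _ hμ => ?_).symm
  · rw [Set.Finite.mem_toFinset, Set.mem_ofPred_eq, ← Submodule.one_le_finrank_iff,
      LinearMap.finrank_maxGenEigenspace_eq, ← count_roots, Multiset.one_le_count_iff_mem]
    exact Multiset.mem_toFinset.1 hμ
  · rw [Multiset.mem_toFinset, ← Multiset.count_eq_zero, count_roots] at hμ
    rw [hμ, Nat.cast_zero, zero_mul]

theorem det_one_sub_eq_prod_roots_charpoly [IsAlgClosed K] (f : End K V) :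
    LinearMap.det (1 - f) = (f.charpoly.roots.map (1 - ·)).prod := by
  rw [← map_one (algebraMap K (End K V)), ← LinearMap.eval_charpoly]
  conv_lhs => rw [(IsAlgClosed.splits f.charpoly).eq_prod_roots_of_monic f.charpoly_monic]
  rw [eval_multiset_prod, Multiset.map_map]
  simp

theorem natDegree_det_add_X_smul_le {R n : Type*} [CommRing R] [Fintype n] [DecidableEq n]
    (A B : Matrix n n R) (s : Finset n) (hB : ∀ i ∉ s, ∀ j, B j i = 0) :
    (A.map C + (X : R[X]) • B.map C).det.natDegree ≤ s.card := by
  rw [Matrix.det_apply]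
  refine natDegree_sum_le_of_forall_le _ _ fun g _ => ?_
  have hentry (i : n) : ((A.map C + (X : R[X]) • B.map C) (g i) i).natDegree ≤
      if i ∈ s then 1 else 0 := by
    simp only [Matrix.add_apply, Matrix.smul_apply, Matrix.map_apply, smul_eq_mul]
    split_ifs with hi
    · compute_degree
    · simp [hB i hi]
  calc (Equiv.Perm.sign g • ∏ i, (A.map C + (X : R[X]) • B.map C) (g i) i).natDegree
      ≤ (∏ i, (A.map C + (X : R[X]) • B.map C) (g i) i).natDegree := by
        rcases Int.units_eq_one_or (Equiv.Perm.sign g) with hg | hg <;> simp [hg]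
    _ ≤ ∑ i, ((A.map C + (X : R[X]) • B.map C) (g i) i).natDegree := natDegree_prod_le _ _
    _ ≤ ∑ i, if i ∈ s then 1 else 0 := Finset.sum_le_sum fun i _ => hentry i
    _ = s.card := by simp

theorem map_eval_add_X_smul {R n : Type*} [CommRing R] (A B : Matrix n n R) (z : R) :
    (A.map C + (X : R[X]) • B.map C).map (evalRingHom z) = A + z • B := by
  ext i j
  simp only [Matrix.map_apply, Matrix.add_apply, Matrix.smul_apply, smul_eq_mul,
    coe_evalRingHom, eval_add, eval_mul, eval_C, eval_X]

theorem exists_polynomial_det_one_sub_add_smul (a b : End K V) :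
    ∃ P : K[X], P.natDegree ≤ finrank K (LinearMap.range b) ∧
      ∀ z : K, LinearMap.det (1 - (a + z • b)) = P.eval z := by
  classical
  obtain ⟨W, hW⟩ := (LinearMap.ker b).exists_isCompl
  let e := ((finBasis K (LinearMap.ker b)).prod (finBasis K W)).map
    (Submodule.prodEquivOfIsCompl _ _ hW)
  let A := LinearMap.toMatrix e e (1 - a)
  let B := LinearMap.toMatrix e e (-b)
  refine ⟨(A.map C + (X : K[X]) • B.map C).det, ?_, fun z => ?_⟩
  · have hB : ∀ i ∉ Finset.univ.map Function.Embedding.inr, ∀ j, B j i = 0 := by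
      rintro (i | i) hi j
      · have : b (e (Sum.inl i)) = 0 := by simp [e]
        simp [B, LinearMap.toMatrix_apply, this]
      · simp at hi
    refine (natDegree_det_add_X_smul_le A B _ hB).trans_eq ?_
    have h1 := Submodule.finrank_add_eq_of_isCompl hW
    have h2 := LinearMap.finrank_range_add_finrank_ker b
    rw [Finset.card_map, Finset.card_univ, Fintype.card_fin]
    omega
  · rw [← coe_evalRingHom, RingHom.map_det, RingHom.mapMatrix_apply, map_eval_add_X_smul,
      ← LinearMap.det_toMatrix e]
    congr 1
    simp only [A, B, map_sub, map_add, map_smul, map_neg]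
    module

theorem exists_polynomial_trace_add_smul_pow (a b : End K V) (k : ℕ) :
    ∃ P : K[X], ∀ z : K, LinearMap.trace K V ((a + z • b) ^ k) = P.eval z := by
  classical
  let e := finBasis K V
  let A := LinearMap.toMatrix e e a
  let B := LinearMap.toMatrix e e b
  refine ⟨((A.map C + (X : K[X]) • B.map C) ^ k).trace, fun z => ?_⟩
  rw [LinearMap.trace_eq_matrix_trace K e, ← LinearMap.toMatrix_pow, ← coe_evalRingHom,
    AddMonoidHom.map_trace, ← RingHom.mapMatrix_apply, map_pow, RingHom.mapMatrix_apply,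
    map_eval_add_X_smul, map_add, map_smul]

end LinearAlgebra

section FiniteRankOperators

open Module

variable {X : Type*} [NormedAddCommGroup X] [NormedSpace ℂ X]

theorem opRange_add_le (A B : X →L[ℂ] X) : opRange (A + B) ≤ opRange A ⊔ opRange B :=
  LinearMap.range_add_le _ _

theorem opRange_smul_le (c : ℂ) (A : X →L[ℂ] X) : opRange (c • A) ≤ opRange A := by
  rintro _ ⟨x, rfl⟩
  exact ⟨c • x, map_smul A c x⟩

theorem opRange_mul_le (A B : X →L[ℂ] X) : opRange (A * B) ≤ opRange A :=
  LinearMap.range_comp_le_range _ _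

theorem opRange_mul_eq_map (A B : X →L[ℂ] X) :
    opRange (A * B) = (opRange B).map (A : X →ₗ[ℂ] X) :=
  LinearMap.range_comp _ _

theorem opRange_pow_le (A : X →L[ℂ] X) {k : ℕ} (hk : k ≠ 0) : opRange (A ^ k) ≤ opRange A := by
  obtain ⟨n, rfl⟩ := Nat.exists_eq_succ_of_ne_zero hk
  exact pow_succ' A n ▸ opRange_mul_le A (A ^ n)

theorem IsFiniteRank.of_le {A B : X →L[ℂ] X} (hB : IsFiniteRank B) (h : opRange A ≤ opRange B) :
    IsFiniteRank A :=
  have : FiniteDimensional ℂ (opRange B) := hB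
  Submodule.finiteDimensional_of_le h

theorem IsFiniteRank.add {A B : X →L[ℂ] X} (hA : IsFiniteRank A) (hB : IsFiniteRank B) :
    IsFiniteRank (A + B) :=
  have : FiniteDimensional ℂ (opRange A) := hA
  have : FiniteDimensional ℂ (opRange B) := hB
  Submodule.finiteDimensional_of_le (opRange_add_le A B)

theorem IsFiniteRank.smul {A : X →L[ℂ] X} (hA : IsFiniteRank A) (c : ℂ) :
    IsFiniteRank (c • A) :=
  hA.of_le (opRange_smul_le c A)

theorem IsFiniteRank.sub {A B : X →L[ℂ] X} (hA : IsFiniteRank A) (hB : IsFiniteRank B) :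
    IsFiniteRank (A - B) := by
  simpa [sub_eq_add_neg] using hA.add (hB.smul (-1))

theorem IsFiniteRank.mul_right {A : X →L[ℂ] X} (hA : IsFiniteRank A) (B : X →L[ℂ] X) :
    IsFiniteRank (A * B) :=
  hA.of_le (opRange_mul_le A B)

theorem IsFiniteRank.mul_left {B : X →L[ℂ] X} (hB : IsFiniteRank B) (A : X →L[ℂ] X) :
    IsFiniteRank (A * B) := by
  have : FiniteDimensional ℂ (opRange B) := hB
  rw [IsFiniteRank, opRange_mul_eq_map]
  infer_instance

theorem IsFiniteRank.pow {A : X →L[ℂ] X} (hA : IsFiniteRank A) {k : ℕ} (hk : k ≠ 0) :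
    IsFiniteRank (A ^ k) :=
  hA.of_le (opRange_pow_le A hk)

/-- The restriction of `F` to a subspace containing its range. Two operators are compared by
restricting both to the sum of their ranges. -/
noncomputable def restrictTo (F : X →L[ℂ] X) (V : Submodule ℂ X) (hV : opRange F ≤ V) : End ℂ V :=
  (F : X →ₗ[ℂ] X).restrict (p := V) (q := V) fun x _ => hV (LinearMap.mem_range_self _ x)

theorem restrictTo_pow {F : X →L[ℂ] X} {V : Submodule ℂ X} (hV : opRange F ≤ V) {k : ℕ}
    (hk : k ≠ 0) :
    restrictTo (F ^ k) V ((opRange_pow_le F hk).trans hV) = restrictTo F V hV ^ k := by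
  ext x
  rw [restrictTo, restrictTo, End.pow_restrict]
  simp [LinearMap.restrict_apply]

theorem genEigenspaceOf_le {F : X →L[ℂ] X} {V : Submodule ℂ X} (hV : opRange F ≤ V) {μ : ℂ}
    (hμ : μ ≠ 0) : genEigenspaceOf F μ ≤ V := by
  intro x hx
  obtain ⟨k, hk⟩ := (End.mem_maxGenEigenspace _ _ _).1 hx
  clear hx
  induction k generalizing x with
  | zero =>
    have hx : x = 0 := by simpa using hk
    exact hx ▸ V.zero_mem
  | succ k ih =>
    rw [pow_succ, End.mul_apply] at hk
    have hsmul : μ • x ∈ V := by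
      simpa using V.sub_mem (hV (LinearMap.mem_range_self _ x)) (ih hk)
    exact (V.smul_mem_iff hμ).1 hsmul

theorem rootMultiplicity_charpoly_restrictTo {F : X →L[ℂ] X} {V : Submodule ℂ X}
    [FiniteDimensional ℂ V] (hV : opRange F ≤ V) {μ : ℂ} (hμ : μ ≠ 0) :
    (restrictTo F V hV).charpoly.rootMultiplicity μ = finrank ℂ (genEigenspaceOf F μ) := by
  have h : End.maxGenEigenspace (restrictTo F V hV) μ = (genEigenspaceOf F μ).comap V.subtype :=
    End.genEigenspace_restrict _ _ _ _ _
  rw [← LinearMap.finrank_maxGenEigenspace_eq, h,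
    (Submodule.comapSubtypeEquivOfLe (genEigenspaceOf_le hV hμ)).finrank_eq]

open Classical in
/-- The nonzero eigenvalues of a finite rank operator, repeated according to their algebraic
multiplicity. It is empty by convention if the operator has infinite rank. -/
noncomputable def nonzeroEigenvalues (F : X →L[ℂ] X) : Multiset ℂ :=
  if h : IsFiniteRank F then
    haveI : FiniteDimensional ℂ (opRange F) := h
    (restrictRange F).charpoly.roots.filter (· ≠ 0)
  else 0

theorem nonzeroEigenvalues_eq_filter_roots {F : X →L[ℂ] X} {V : Submodule ℂ X}
    [FiniteDimensional ℂ V] (hV : opRange F ≤ V) :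
    nonzeroEigenvalues F = (restrictTo F V hV).charpoly.roots.filter (· ≠ 0) := by
  have hF : IsFiniteRank F := Submodule.finiteDimensional_of_le hV
  have : FiniteDimensional ℂ (opRange F) := hF
  rw [nonzeroEigenvalues, dif_pos hF]
  ext μ
  rcases eq_or_ne μ 0 with rfl | hμ
  · rw [Multiset.count_filter_of_neg (by simp), Multiset.count_filter_of_neg (by simp)]
  · rw [Multiset.count_filter_of_pos (p := (· ≠ 0)) hμ,
      Multiset.count_filter_of_pos (p := (· ≠ 0)) hμ, Polynomial.count_roots,
      Polynomial.count_roots, rootMultiplicity_charpoly_restrictTo hV hμ]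
    exact rootMultiplicity_charpoly_restrictTo le_rfl hμ

theorem ne_zero_of_mem_nonzeroEigenvalues {F : X →L[ℂ] X} {μ : ℂ}
    (h : μ ∈ nonzeroEigenvalues F) : μ ≠ 0 := by
  rw [nonzeroEigenvalues] at h
  split_ifs at h
  · exact (Multiset.mem_filter.1 h).2
  · exact absurd h (Multiset.notMem_zero μ)

theorem count_nonzeroEigenvalues {F : X →L[ℂ] X} (hF : IsFiniteRank F) {μ : ℂ} (hμ : μ ≠ 0) :
    (nonzeroEigenvalues F).count μ = finrank ℂ (genEigenspaceOf F μ) := by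
  have : FiniteDimensional ℂ (opRange F) := hF
  rw [nonzeroEigenvalues_eq_filter_roots le_rfl, Multiset.count_filter_of_pos (p := (· ≠ 0)) hμ,
    Polynomial.count_roots, rootMultiplicity_charpoly_restrictTo le_rfl hμ]

theorem card_nonzeroEigenvalues_le {F : X →L[ℂ] X} (hF : IsFiniteRank F) :
    (nonzeroEigenvalues F).card ≤ finrank ℂ (opRange F) := by
  have : FiniteDimensional ℂ (opRange F) := hF
  rw [nonzeroEigenvalues_eq_filter_roots le_rfl,
    ← LinearMap.charpoly_natDegree (restrictTo F _ le_rfl)]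
  exact (Multiset.card_le_card (Multiset.filter_le _ _)).trans (Polynomial.card_roots' _)

theorem hasEigenvalue_of_mem_nonzeroEigenvalues {F : X →L[ℂ] X} (hF : IsFiniteRank F) {μ : ℂ}
    (h : μ ∈ nonzeroEigenvalues F) : End.HasEigenvalue (F : X →ₗ[ℂ] X) μ := by
  have hμ := ne_zero_of_mem_nonzeroEigenvalues h
  rw [← Multiset.one_le_count_iff_mem, count_nonzeroEigenvalues hF hμ] at h
  have hgen : End.HasUnifEigenvalue (F : X →ₗ[ℂ] X) μ ⊤ := fun hbot => by
    rw [genEigenspaceOf, End.maxGenEigenspace, hbot, finrank_bot] at h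
    omega
  exact (End.hasUnifEigenvalue_iff_hasUnifEigenvalue_one ENat.top_pos).1 hgen

theorem norm_le_opNorm_of_hasEigenvalue {F : X →L[ℂ] X} {μ : ℂ}
    (h : End.HasEigenvalue (F : X →ₗ[ℂ] X) μ) : ‖μ‖ ≤ ‖F‖ := by
  obtain ⟨v, hv⟩ := h.exists_hasEigenvector
  have hF : F v = μ • v := hv.apply_eq_smul
  exact le_of_mul_le_mul_right (norm_smul μ v ▸ hF ▸ F.le_opNorm v) (norm_pos_iff.2 hv.2)

@[to_additive]
theorem prod_map_filter_ne_zero {M : Type*} [CommMonoid M] (s : Multiset ℂ) {g : ℂ → M}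
    (hg : g 0 = 1) : ((s.filter (· ≠ 0)).map g).prod = (s.map g).prod := by
  conv_rhs => rw [← Multiset.filter_add_not (· ≠ 0) s, Multiset.map_add, Multiset.prod_add]
  rw [Multiset.prod_eq_one (s := (s.filter (¬ · ≠ 0)).map g) fun x hx => ?_, mul_one]
  obtain ⟨y, hy, rfl⟩ := Multiset.mem_map.1 hx
  rw [not_not.1 (Multiset.mem_filter.1 hy).2, hg]

theorem det_one_sub_restrictTo {F : X →L[ℂ] X} {V : Submodule ℂ X} [FiniteDimensional ℂ V]
    (hV : opRange F ≤ V) :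
    LinearMap.det (1 - restrictTo F V hV) = ((nonzeroEigenvalues F).map (1 - ·)).prod := by
  rw [det_one_sub_eq_prod_roots_charpoly, nonzeroEigenvalues_eq_filter_roots hV,
    prod_map_filter_ne_zero _ (sub_zero 1)]

theorem trace_restrictTo_pow {F : X →L[ℂ] X} {V : Submodule ℂ X} [FiniteDimensional ℂ V]
    (hV : opRange F ≤ V) {k : ℕ} (hk : k ≠ 0) :
    LinearMap.trace ℂ V (restrictTo F V hV ^ k) = ((nonzeroEigenvalues F).map (· ^ k)).sum := by
  rw [trace_pow_eq_sum_roots_charpoly, nonzeroEigenvalues_eq_filter_roots hV,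
    sum_map_filter_ne_zero (g := (· ^ k)) _ (zero_pow hk)]

theorem trace_restrictTo {F : X →L[ℂ] X} {V : Submodule ℂ X} [FiniteDimensional ℂ V]
    (hV : opRange F ≤ V) :
    LinearMap.trace ℂ V (restrictTo F V hV) = (nonzeroEigenvalues F).sum := by
  simpa using trace_restrictTo_pow hV one_ne_zero

theorem detOneSub_eq_prod {F : X →L[ℂ] X} (hF : IsFiniteRank F) :
    detOneSub F = ((nonzeroEigenvalues F).map (1 - ·)).prod :=
  have : FiniteDimensional ℂ (opRange F) := hF
  det_one_sub_restrictTo le_rfl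

theorem finTrace_eq_sum {F : X →L[ℂ] X} (hF : IsFiniteRank F) :
    finTrace F = (nonzeroEigenvalues F).sum :=
  have : FiniteDimensional ℂ (opRange F) := hF
  trace_restrictTo le_rfl

theorem detOneSub_eq_det {F : X →L[ℂ] X} {V : Submodule ℂ X} [FiniteDimensional ℂ V]
    (hV : opRange F ≤ V) : detOneSub F = LinearMap.det (1 - restrictTo F V hV) := by
  rw [detOneSub_eq_prod (Submodule.finiteDimensional_of_le hV), det_one_sub_restrictTo]

theorem finTrace_eq_trace {F : X →L[ℂ] X} {V : Submodule ℂ X} [FiniteDimensional ℂ V]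
    (hV : opRange F ≤ V) : finTrace F = LinearMap.trace ℂ V (restrictTo F V hV) := by
  rw [finTrace_eq_sum (Submodule.finiteDimensional_of_le hV), trace_restrictTo]

theorem finTrace_pow_eq_trace {F : X →L[ℂ] X} {V : Submodule ℂ X} [FiniteDimensional ℂ V]
    (hV : opRange F ≤ V) {k : ℕ} (hk : k ≠ 0) :
    finTrace (F ^ k) = LinearMap.trace ℂ V (restrictTo F V hV ^ k) := by
  rw [finTrace_eq_trace ((opRange_pow_le F hk).trans hV), restrictTo_pow hV hk]

theorem finTrace_pow_eq_sum {F : X →L[ℂ] X} (hF : IsFiniteRank F) {k : ℕ} (hk : k ≠ 0) :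
    finTrace (F ^ k) = ((nonzeroEigenvalues F).map (· ^ k)).sum := by
  have : FiniteDimensional ℂ (opRange F) := hF
  rw [finTrace_pow_eq_trace le_rfl hk, trace_restrictTo_pow le_rfl hk]

theorem finTrace_add {A B : X →L[ℂ] X} (hA : IsFiniteRank A) (hB : IsFiniteRank B) :
    finTrace (A + B) = finTrace A + finTrace B := by
  have : FiniteDimensional ℂ (opRange A) := hA
  have : FiniteDimensional ℂ (opRange B) := hB
  rw [finTrace_eq_trace (opRange_add_le A B), finTrace_eq_trace (le_sup_left : _ ≤ _ ⊔ opRange B),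
    finTrace_eq_trace (le_sup_right : _ ≤ opRange A ⊔ _), ← map_add]
  rfl

theorem norm_finTrace_le {F : X →L[ℂ] X} (hF : IsFiniteRank F) :
    ‖finTrace F‖ ≤ finrank ℂ (opRange F) * ‖F‖ := by
  have hle : ∀ x ∈ (nonzeroEigenvalues F).map (‖·‖), x ≤ ‖F‖ := by
    rintro _ hx
    obtain ⟨μ, hμ, rfl⟩ := Multiset.mem_map.1 hx
    exact norm_le_opNorm_of_hasEigenvalue (hasEigenvalue_of_mem_nonzeroEigenvalues hF hμ)
  calc ‖finTrace F‖ ≤ ((nonzeroEigenvalues F).map (‖·‖)).sum :=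
        finTrace_eq_sum hF ▸ norm_multiset_sum_le _
    _ ≤ (nonzeroEigenvalues F).card • ‖F‖ := by
        simpa using Multiset.sum_le_card_nsmul _ _ hle
    _ ≤ finrank ℂ (opRange F) * ‖F‖ := by
        rw [nsmul_eq_mul]
        gcongr
        exact card_nonzeroEigenvalues_le hF

theorem opRange_add_smul_le (A B : X →L[ℂ] X) (z : ℂ) :
    opRange (A + z • B) ≤ opRange A ⊔ opRange B :=
  (opRange_add_le A _).trans (sup_le_sup_left (opRange_smul_le z B) _)

theorem exists_polynomial_detOneSub_add_smul {A B : X →L[ℂ] X} (hA : IsFiniteRank A)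
    (hB : IsFiniteRank B) : ∃ P : Polynomial ℂ, P.natDegree ≤ finrank ℂ (opRange B) ∧
      ∀ z : ℂ, detOneSub (A + z • B) = P.eval z := by
  have : FiniteDimensional ℂ (opRange A) := hA
  have : FiniteDimensional ℂ (opRange B) := hB
  let V := opRange A ⊔ opRange B
  have hBV : opRange B ≤ V := le_sup_right
  obtain ⟨P, hP, h⟩ := exists_polynomial_det_one_sub_add_smul
    (restrictTo A V le_sup_left) (restrictTo B V hBV)
  refine ⟨P, hP.trans ?_, fun z => ?_⟩
  · have hrange : (LinearMap.range (restrictTo B V hBV)).map V.subtype ≤ opRange B := by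
      rintro _ ⟨_, ⟨x, rfl⟩, rfl⟩
      exact ⟨x, rfl⟩
    exact (Submodule.finrank_map_subtype_eq V _).symm.le.trans (Submodule.finrank_mono hrange)
  · rw [detOneSub_eq_det (opRange_add_smul_le A B z), ← h]
    rfl

theorem exists_polynomial_finTrace_add_smul_pow {A B : X →L[ℂ] X} (hA : IsFiniteRank A)
    (hB : IsFiniteRank B) {k : ℕ} (hk : k ≠ 0) :
    ∃ P : Polynomial ℂ, ∀ z : ℂ, finTrace ((A + z • B) ^ k) = P.eval z := by
  have : FiniteDimensional ℂ (opRange A) := hA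
  have : FiniteDimensional ℂ (opRange B) := hB
  obtain ⟨P, h⟩ := exists_polynomial_trace_add_smul_pow
    (restrictTo A (opRange A ⊔ opRange B) le_sup_left)
    (restrictTo B (opRange A ⊔ opRange B) le_sup_right) k
  refine ⟨P, fun z => ?_⟩
  rw [finTrace_pow_eq_trace (opRange_add_smul_le A B z) hk, ← h]
  rfl

theorem differentiable_regDet_add_smul (p : ℝ) {A B : X →L[ℂ] X} (hA : IsFiniteRank A)
    (hB : IsFiniteRank B) : Differentiable ℂ fun z : ℂ => regDet p (A + z • B) := by
  obtain ⟨P, -, hP⟩ := exists_polynomial_detOneSub_add_smul hA hB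
  simp only [regDet, hP]
  refine P.differentiable.mul (Differentiable.cexp (Differentiable.fun_sum fun k hk => ?_))
  obtain ⟨Q, hQ⟩ := exists_polynomial_finTrace_add_smul_pow hA hB
    (Nat.one_le_iff_ne_zero.1 (Finset.mem_Ico.1 hk).1)
  simp only [hQ]
  exact Q.differentiable.const_mul _

end FiniteRankOperators

section CompactOperators

open Module Filter

variable {X : Type*} [NormedAddCommGroup X] [NormedSpace ℂ X]

theorem IsFiniteRank.isCompactOperator {F : X →L[ℂ] X} (hF : IsFiniteRank F) :
    IsCompactOperator F := by
  have : FiniteDimensional ℂ (opRange F) := hF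
  have : ProperSpace (opRange F) := FiniteDimensional.proper ℂ (opRange F)
  have hι : IsCompactOperator (opRange F).subtypeL :=
    isCompactOperator_of_locallyCompactSpace_rng _
  exact hι.comp_clm (F.codRestrict (opRange F) fun x => ⟨x, rfl⟩)

theorem exists_norm_le_of_isClosed_of_lt {V W : Submodule ℂ X} (hV : IsClosed (V : Set X))
    (hVW : V < W) : ∃ x ∈ W, ‖x‖ ≤ 3 ∧ ∀ y ∈ V, 1 ≤ ‖x - y‖ := by
  obtain ⟨x, hxW, hxV⟩ := Set.exists_of_ssubset hVW
  obtain ⟨⟨x, hx⟩, hx3, hxV⟩ := riesz_lemma_of_norm_lt (c := (2 : ℂ)) (by norm_num) (R := 3)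
    (by norm_num) (F := V.comap W.subtype) (hV.preimage continuous_subtype_val) ⟨⟨x, hxW⟩, hxV⟩
  exact ⟨x, hx, hx3, fun y hy => by simpa using hxV ⟨y, hVW.le hy⟩ hy⟩

theorem exists_subseq_tendsto_of_isCompactOperator {L : X →L[ℂ] X} (hL : IsCompactOperator L)
    {y : ℕ → X} {r : ℝ} (hy : ∀ n, ‖y n‖ ≤ r) :
    ∃ (w : X) (ψ : ℕ → ℕ), StrictMono ψ ∧ Tendsto (fun n => L (y (ψ n))) atTop (𝓝 w) := by
  obtain ⟨K, hK, hLK⟩ := hL.image_closedBall_subset_compact (𝕜₁ := ℂ) (f := (L : X →ₗ[ℂ] X)) r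
  obtain ⟨w, -, ψ, hψ, hw⟩ := hK.tendsto_subseq (x := fun n => L (y n))
    fun n => hLK ⟨y n, by simpa using hy n, rfl⟩
  exact ⟨w, ψ, hψ, hw⟩

theorem not_strictMono_of_map_sub_smul_le {L : X →L[ℂ] X} (hL : IsCompactOperator L) {μ : ℂ}
    (hμ : μ ≠ 0) {W : ℕ → Submodule ℂ X} (hclosed : ∀ n, IsClosed (W n : Set X))
    (hW : ∀ n, ∀ x ∈ W (n + 1), L x - μ • x ∈ W n) : ¬ StrictMono W := by
  intro hmono
  choose x hxW hx3 hxfar using fun n =>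
    exists_norm_le_of_isClosed_of_lt (hclosed n) (hmono (Nat.lt_succ_self n))
  have hsep : ∀ m n, m < n → ‖μ‖ ≤ ‖L (x n) - L (x m)‖ := by
    intro m n hmn
    have hmem : L (x m) - (L (x n) - μ • x n) ∈ W n := by
      refine (W n).sub_mem (hmono.monotone hmn ?_) (hW n _ (hxW n))
      simpa using (W (m + 1)).add_mem (hmono.monotone m.le_succ (hW m _ (hxW m)))
        ((W (m + 1)).smul_mem μ (hxW m))
    have heq : L (x n) - L (x m) = μ • (x n - μ⁻¹ • (L (x m) - (L (x n) - μ • x n))) := by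
      rw [smul_sub, smul_inv_smul₀ hμ]
      abel
    rw [heq, norm_smul]
    exact le_mul_of_one_le_right (norm_nonneg μ) (hxfar n _ ((W n).smul_mem _ hmem))
  obtain ⟨w, ψ, hψ, hw⟩ := exists_subseq_tendsto_of_isCompactOperator hL hx3
  obtain ⟨N, hN⟩ := Metric.cauchySeq_iff'.1 hw.cauchySeq ‖μ‖ (norm_pos_iff.2 hμ)
  have hlt := hN (N + 1) N.le_succ
  rw [dist_eq_norm] at hlt
  exact hlt.not_ge (hsep _ _ (hψ N.lt_succ_self))

theorem exists_subseq_tendsto_of_isCompactOperator_sub {T : X →L[ℂ] X} {c : ℂ} (hc : c ≠ 0)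
    (hT : IsCompactOperator (T - c • (1 : X →L[ℂ] X))) {y : ℕ → X} {r : ℝ}
    (hy : ∀ n, ‖y n‖ ≤ r) (hTy : Tendsto (fun n => T (y n)) atTop (𝓝 0)) :
    ∃ (v : X) (ψ : ℕ → ℕ), StrictMono ψ ∧ T v = 0 ∧ Tendsto (y ∘ ψ) atTop (𝓝 v) := by
  obtain ⟨w, ψ, hψ, hw⟩ := exists_subseq_tendsto_of_isCompactOperator hT hy
  have hTψ := hTy.comp hψ.tendsto_atTop
  have hlim : Tendsto (y ∘ ψ) atTop (𝓝 (c⁻¹ • (0 - w))) := by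
    refine ((hTψ.sub hw).const_smul c⁻¹).congr fun n => ?_
    simp [hc]
  exact ⟨_, ψ, hψ, tendsto_nhds_unique ((T.continuous.tendsto _).comp hlim) hTψ, hlim⟩

theorem finiteDimensional_ker_of_isCompactOperator_sub {T : X →L[ℂ] X} {c : ℂ} (hc : c ≠ 0)
    (hT : IsCompactOperator (T - c • (1 : X →L[ℂ] X))) :
    FiniteDimensional ℂ (LinearMap.ker (T : X →ₗ[ℂ] X)) := by
  refine FiniteDimensional.of_isCompact_closedBall₀ ℂ one_pos
    (IsSeqCompact.isCompact fun y hy => ?_)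
  have hker : ∀ n, T (y n) = 0 := fun n => (y n).2
  have hy1 : ∀ n, ‖(y n : X)‖ ≤ 1 := fun n => by simpa using hy n
  obtain ⟨v, ψ, hψ, hv, hlim⟩ :=
    exists_subseq_tendsto_of_isCompactOperator_sub hc hT hy1 (by simp [hker])
  have hlim' : Tendsto (y ∘ ψ) atTop (𝓝 ⟨v, hv⟩) := tendsto_subtype_rng.2 hlim
  exact ⟨⟨v, hv⟩, Metric.isClosed_closedBall.mem_of_tendsto hlim' (.of_forall fun n => hy _),
    ψ, hψ, hlim'⟩

theorem exists_mul_norm_le_of_disjoint_ker {T : X →L[ℂ] X} {c : ℂ} (hc : c ≠ 0)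
    (hT : IsCompactOperator (T - c • (1 : X →L[ℂ] X))) {Y : Submodule ℂ X}
    (hY : IsClosed (Y : Set X)) (hdisj : Disjoint (LinearMap.ker (T : X →ₗ[ℂ] X)) Y) :
    ∃ ε > 0, ∀ y ∈ Y, ε * ‖y‖ ≤ ‖T y‖ := by
  by_contra! hcon
  have hseq : ∀ n : ℕ, ∃ y ∈ Y, ‖y‖ = 1 ∧ ‖T y‖ ≤ 1 / ((n : ℝ) + 1) := by
    intro n
    obtain ⟨y, hyY, hy⟩ := hcon (1 / ((n : ℝ) + 1)) (by positivity)
    have hy0 : 0 < ‖y‖ := pos_of_mul_pos_right ((norm_nonneg _).trans_lt hy) (by positivity)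
    refine ⟨((‖y‖⁻¹ : ℝ) : ℂ) • y, Y.smul_mem _ hyY, by simp [norm_smul, hy0.ne'], ?_⟩
    rw [map_smul, norm_smul, Complex.norm_real, norm_inv, norm_norm, inv_mul_le_iff₀ hy0, mul_comm]
    exact hy.le
  choose y hyY hy1 hyT using hseq
  have hT0 : Tendsto (fun n => T (y n)) atTop (𝓝 0) :=
    squeeze_zero_norm hyT tendsto_one_div_add_atTop_nhds_zero_nat
  obtain ⟨v, ψ, -, hv, hlim⟩ :=
    exists_subseq_tendsto_of_isCompactOperator_sub hc hT (fun n => (hy1 n).le) hT0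
  have hvY : v ∈ Y := hY.mem_of_tendsto hlim (.of_forall fun n => hyY _)
  have hv1 : ‖v‖ = 1 := tendsto_nhds_unique hlim.norm (by simp [hy1])
  rw [Submodule.disjoint_def.1 hdisj v hv hvY, norm_zero] at hv1
  exact zero_ne_one hv1

theorem eventually_finrank_le_finrank_ker {T : X →L[ℂ] X} {c : ℂ} (hc : c ≠ 0)
    (hT : IsCompactOperator (T - c • (1 : X →L[ℂ] X))) :
    ∀ᶠ S : X →L[ℂ] X in 𝓝 T, ∀ M ≤ LinearMap.ker (S : X →ₗ[ℂ] X),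
      finrank ℂ M ≤ finrank ℂ (LinearMap.ker (T : X →ₗ[ℂ] X)) := by
  have := finiteDimensional_ker_of_isCompactOperator_sub hc hT
  obtain ⟨Y, hYc, hY⟩ := (Submodule.ClosedComplemented.of_finiteDimensional
    (LinearMap.ker (T : X →ₗ[ℂ] X))).exists_isClosed_isCompl
  obtain ⟨ε, hε, hbelow⟩ := exists_mul_norm_le_of_disjoint_ker hc hT hYc hY.disjoint
  filter_upwards [Metric.ball_mem_nhds T hε] with S hS M hM
  let π := (Submodule.projectionOnto _ _ hY).comp M.subtype
  refine LinearMap.finrank_le_finrank_of_injective (f := π) (LinearMap.ker_eq_bot.1 ?_)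
  rw [LinearMap.ker_eq_bot']
  rintro ⟨x, hx⟩ hπ
  have hxY : x ∈ Y := by rwa [← Submodule.ker_projectionOnto hY]
  have hSx : S x = 0 := hM hx
  by_contra hx0
  have hx0 : 0 < ‖x‖ := norm_pos_iff.2 fun h => hx0 (Subtype.ext h)
  refine lt_irrefl (ε * ‖x‖) ?_
  calc ε * ‖x‖ ≤ ‖T x‖ := hbelow x hxY
    _ ≤ ‖S - T‖ * ‖x‖ := by simpa [hSx] using (S - T).le_opNorm x
    _ < ε * ‖x‖ := by
      rw [Metric.mem_ball, dist_eq_norm] at hS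
      gcongr

theorem isCompactOperator_aeval_sub {L : X →L[ℂ] X} (hL : IsCompactOperator L)
    (q : Polynomial ℂ) :
    IsCompactOperator (Polynomial.aeval L q - q.coeff 0 • (1 : X →L[ℂ] X)) := by
  have h : Polynomial.aeval L q - q.coeff 0 • (1 : X →L[ℂ] X) =
      Polynomial.aeval L q.divX * L := by
    conv_lhs => rw [← Polynomial.divX_mul_X_add q]
    simp [Algebra.algebraMap_eq_smul_one]
  rw [h]
  exact hL.clm_comp (Polynomial.aeval L q.divX)

theorem coe_aeval (L : X →L[ℂ] X) (q : Polynomial ℂ) :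
    ((Polynomial.aeval L q : X →L[ℂ] X) : X →ₗ[ℂ] X) =
      Polynomial.aeval (L : X →ₗ[ℂ] X) q :=
  (Polynomial.aeval_algHom_apply ({ ContinuousLinearMap.toLinearMapRingHom with
    commutes' := fun _ => rfl } : (X →L[ℂ] X) →ₐ[ℂ] (X →ₗ[ℂ] X)) L q).symm

theorem ker_aeval_X_sub_C_pow (L : X →L[ℂ] X) (μ : ℂ) (k : ℕ) :
    LinearMap.ker ((Polynomial.aeval L ((Polynomial.X - Polynomial.C μ) ^ k) : X →L[ℂ] X) :
      X →ₗ[ℂ] X) = End.genEigenspace (L : X →ₗ[ℂ] X) μ k := by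
  rw [coe_aeval, End.genEigenspace_nat]
  simp [Algebra.algebraMap_eq_smul_one]

theorem coeff_zero_X_sub_C_pow_ne_zero {μ : ℂ} (hμ : μ ≠ 0) (k : ℕ) :
    ((Polynomial.X - Polynomial.C μ) ^ k : Polynomial ℂ).coeff 0 ≠ 0 := by
  rw [Polynomial.coeff_zero_eq_eval_zero]
  simp [hμ]

theorem finiteDimensional_genEigenspace {L : X →L[ℂ] X} (hL : IsCompactOperator L) {μ : ℂ}
    (hμ : μ ≠ 0) (k : ℕ) : FiniteDimensional ℂ (End.genEigenspace (L : X →ₗ[ℂ] X) μ k) := by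
  rw [← ker_aeval_X_sub_C_pow]
  exact finiteDimensional_ker_of_isCompactOperator_sub (coeff_zero_X_sub_C_pow_ne_zero hμ k)
    (isCompactOperator_aeval_sub hL _)

theorem exists_genEigenspaceOf_eq {L : X →L[ℂ] X} (hL : IsCompactOperator L) {μ : ℂ}
    (hμ : μ ≠ 0) : ∃ k : ℕ, genEigenspaceOf L μ = End.genEigenspace (L : X →ₗ[ℂ] X) μ k := by
  let G : ℕ → Submodule ℂ X := fun k => End.genEigenspace (L : X →ₗ[ℂ] X) μ k
  have hmono : Monotone G := fun k l hkl =>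
    (End.genEigenspace (L : X →ₗ[ℂ] X) μ).mono (by exact_mod_cast hkl)
  have hclosed : ∀ k, IsClosed (G k : Set X) := fun k => by
    rw [show G k = _ from (ker_aeval_X_sub_C_pow L μ k).symm]
    exact ContinuousLinearMap.isClosed_ker _
  have hstep : ∀ k, ∀ x ∈ G (k + 1), L x - μ • x ∈ G k := by
    intro k x hx
    rw [End.mem_genEigenspace_nat, LinearMap.mem_ker] at hx ⊢
    simpa [pow_succ] using hx
  have hstab : ∃ k, G k = G (k + 1) := by
    by_contra! hne
    exact not_strictMono_of_map_sub_smul_le hL hμ hclosed hstep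
      (strictMono_nat_of_lt_succ fun k => (hmono k.le_succ).lt_of_ne (hne k))
  obtain ⟨k, hk⟩ := hstab
  refine ⟨k, le_antisymm (fun x hx => ?_) (End.genEigenspace_le_maximal _ _ _)⟩
  obtain ⟨n, hn⟩ := (End.mem_maxGenEigenspace _ _ _).1 hx
  have hxn : x ∈ G (k + n) := hmono (Nat.le_add_left n k) (End.mem_genEigenspace_nat.2 hn)
  simp only [G, End.genEigenspace_nat] at hk hxn ⊢
  rwa [End.ker_pow_constant hk n]

theorem finiteDimensional_genEigenspaceOf {L : X →L[ℂ] X} (hL : IsCompactOperator L) {μ : ℂ}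
    (hμ : μ ≠ 0) : FiniteDimensional ℂ (genEigenspaceOf L μ) := by
  obtain ⟨k, hk⟩ := exists_genEigenspaceOf_eq hL hμ
  rw [hk]
  exact finiteDimensional_genEigenspace hL hμ k

theorem eventually_not_hasEigenvalue {L : X →L[ℂ] X} (hL : IsCompactOperator L) {μ : ℂ}
    (hμ : μ ≠ 0) : ∀ᶠ ν in 𝓝[≠] μ, ¬ End.HasEigenvalue (L : X →ₗ[ℂ] X) ν := by
  obtain ⟨k, hk⟩ := exists_genEigenspaceOf_eq hL hμ
  have := finiteDimensional_genEigenspaceOf hL hμ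
  let T : ℂ → X →L[ℂ] X := fun ν => (L - ν • 1) * Polynomial.aeval L
    ((Polynomial.X - Polynomial.C μ) ^ k)
  have hT : T μ = Polynomial.aeval L ((Polynomial.X - Polynomial.C μ) ^ (k + 1)) := by
    simp [T, pow_succ', Algebra.algebraMap_eq_smul_one]
  have hcont : Tendsto T (𝓝 μ) (𝓝 (T μ)) := Continuous.tendsto (by fun_prop) μ
  rw [hT] at hcont
  filter_upwards [nhdsWithin_le_nhds (hcont.eventually (eventually_finrank_le_finrank_ker
    (coeff_zero_X_sub_C_pow_ne_zero hμ (k + 1)) (isCompactOperator_aeval_sub hL _))),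
    self_mem_nhdsWithin] with ν hν hνμ hev
  obtain ⟨v, hv⟩ := hev.exists_hasEigenvector
  have hvG : v ∉ genEigenspaceOf L μ := fun hvG => hv.2 <| Submodule.disjoint_def.1
    (End.disjoint_genEigenspace (L : X →ₗ[ℂ] X) hνμ 1 ⊤) v hv.1 hvG
  have hlt : genEigenspaceOf L μ < genEigenspaceOf L μ ⊔ Submodule.span ℂ {v} := by
    rwa [left_lt_sup, Submodule.span_singleton_le_iff_mem]
  refine (Submodule.finrank_lt_finrank_of_lt hlt).not_ge ((hν _ (sup_le ?_ ?_)).trans ?_)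
  · intro x hx
    rw [hk, ← ker_aeval_X_sub_C_pow, LinearMap.mem_ker, ContinuousLinearMap.coe_coe] at hx
    exact (congrArg (L - ν • 1 : X →L[ℂ] X) hx).trans (map_zero _)
  · rw [Submodule.span_singleton_le_iff_mem, LinearMap.mem_ker, ContinuousLinearMap.coe_coe]
    have hv' := End.aeval_apply_of_hasEigenvector hv (p := (Polynomial.X - Polynomial.C μ) ^ k)
    rw [← coe_aeval, ContinuousLinearMap.coe_coe] at hv'
    refine (congrArg (L - ν • 1 : X →L[ℂ] X) hv').trans ?_
    have hLv : L v = ν • v := hv.apply_eq_smul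
    simp [hLv]
  · rw [ker_aeval_X_sub_C_pow]
    exact Submodule.finrank_mono (End.genEigenspace_le_maximal _ μ _)

theorem mem_discreteSpectrum [CompleteSpace X] {L : X →L[ℂ] X} (hL : IsCompactOperator L) {μ : ℂ}
    (hμ : μ ≠ 0) (hev : End.HasEigenvalue (L : X →ₗ[ℂ] X) μ) : μ ∈ discreteSpectrum L := by
  refine ⟨hev, ?_, finiteDimensional_genEigenspaceOf hL hμ⟩
  filter_upwards [eventually_not_hasEigenvalue hL hμ,
    nhdsWithin_le_nhds (isOpen_ne.mem_nhds hμ)] with ν hν hν0 hspec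
  exact hν ((hL.hasEigenvalue_iff_mem_spectrum hν0).2 hspec)

end CompactOperators

section EigenvalueStability

open Module Filter

variable {X : Type*} [NormedAddCommGroup X] [NormedSpace ℂ X]

theorem continuous_aeval_prod_X_sub_C (k : ℕ) :
    Continuous fun z : (X →L[ℂ] X) × (Fin k → ℂ) =>
      Polynomial.aeval z.1 (∏ i, (Polynomial.X - Polynomial.C (z.2 i))) := by
  simp only [← List.prod_ofFn, map_list_prod, List.ofFn_eq_map, List.map_map]
  refine continuous_list_prod (M := X →L[ℂ] X) _ fun i _ => ?_
  simp only [Function.comp_apply, map_sub, Polynomial.aeval_X, Polynomial.aeval_C,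
    Algebra.algebraMap_eq_smul_one]
  fun_prop

theorem exists_forall_finrank_le_of_le_ker_aeval_prod {L : X →L[ℂ] X}
    (hL : IsCompactOperator L) {μ : ℂ} (hμ : μ ≠ 0) (k : ℕ) :
    ∃ δ > 0, ∀ ⦃T : X →L[ℂ] X⦄, dist T L < δ → ∀ s : Multiset ℂ, s.card = k →
      (∀ a ∈ s, dist a μ < δ) → ∀ M ≤ LinearMap.ker ((Polynomial.aeval T (s.map fun a =>
        Polynomial.X - Polynomial.C a).prod : X →L[ℂ] X) : X →ₗ[ℂ] X),
        finrank ℂ M ≤ finrank ℂ (genEigenspaceOf L μ) := by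
  have := finiteDimensional_genEigenspaceOf hL hμ
  have hlim := (continuous_aeval_prod_X_sub_C (X := X) k).tendsto (L, fun _ => μ)
  simp only [Finset.prod_const, Finset.card_univ, Fintype.card_fin] at hlim
  obtain ⟨δ, hδ, h⟩ := Metric.eventually_nhds_iff.1 (hlim.eventually
    (eventually_finrank_le_finrank_ker (coeff_zero_X_sub_C_pow_ne_zero hμ k)
      (isCompactOperator_aeval_sub hL _)))
  refine ⟨δ, hδ, fun T hT s hs hsμ M hM => ?_⟩
  obtain ⟨l, rfl⟩ := Quotient.exists_rep s
  obtain rfl : l.length = k := hs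
  refine (h (y := (T, l.get)) ?_ M ?_).trans ?_
  · exact max_lt hT ((dist_pi_lt_iff hδ).2 fun i => hsμ _ (l.get_mem i))
  · convert hM
    simp [← List.prod_ofFn, ← Function.comp_def, ← List.map_ofFn]
  · rw [ker_aeval_X_sub_C_pow]
    exact Submodule.finrank_mono (End.genEigenspace_le_maximal _ μ _)

theorem coe_aeval_restrictTo {F : X →L[ℂ] X} {V : Submodule ℂ X} (hV : opRange F ≤ V)
    (q : Polynomial ℂ) (x : V) :
    (Polynomial.aeval (restrictTo F V hV) q x : X) = Polynomial.aeval F q (x : X) := by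
  rw [← ContinuousLinearMap.coe_coe, coe_aeval]
  induction q using Polynomial.induction_on' with
  | add p q hp hq => simp only [map_add, LinearMap.add_apply, Submodule.coe_add, hp, hq]
  | monomial n a =>
    simp only [Polynomial.aeval_monomial, End.mul_apply, Module.algebraMap_end_apply,
      Submodule.coe_smul, restrictTo]
    rw [End.pow_restrict, LinearMap.coe_restrict_apply]

theorem exists_le_ker_aeval_card_le_finrank {F : X →L[ℂ] X} (hF : IsFiniteRank F)
    {s : Multiset ℂ} (hs : s ≤ nonzeroEigenvalues F) :
    ∃ M ≤ LinearMap.ker ((Polynomial.aeval F (s.map fun a =>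
      Polynomial.X - Polynomial.C a).prod : X →L[ℂ] X) : X →ₗ[ℂ] X), s.card ≤ finrank ℂ M := by
  have : FiniteDimensional ℂ (opRange F) := hF
  rw [nonzeroEigenvalues_eq_filter_roots le_rfl] at hs
  have hcard := card_le_finrank_ker_aeval s (restrictTo F _ le_rfl)
    (hs.trans (Multiset.filter_le _ _))
  refine ⟨_, Submodule.map_le_iff_le_comap.2 fun x hx => ?_,
    hcard.trans_eq (Submodule.finrank_map_subtype_eq _ _).symm⟩
  rw [Submodule.mem_comap, LinearMap.mem_ker, Submodule.subtype_apply,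
    ContinuousLinearMap.coe_coe, ← coe_aeval_restrictTo le_rfl, LinearMap.mem_ker.1 hx,
    Submodule.coe_zero]

open Classical in
theorem exists_mem_nhds_eventually_card_filter_le {L : X →L[ℂ] X} (hL : IsCompactOperator L)
    {μ : ℂ} (hμ : μ ≠ 0) : ∃ U ∈ 𝓝 μ, ∀ᶠ F : X →L[ℂ] X in 𝓝 L, IsFiniteRank F →
      ((nonzeroEigenvalues F).filter (· ∈ U)).card ≤ finrank ℂ (genEigenspaceOf L μ) := by
  set d := finrank ℂ (genEigenspaceOf L μ)
  obtain ⟨δ, hδ, h⟩ := exists_forall_finrank_le_of_le_ker_aeval_prod hL hμ (d + 1)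
  refine ⟨Metric.ball μ δ, Metric.ball_mem_nhds μ hδ, ?_⟩
  filter_upwards [Metric.ball_mem_nhds L hδ] with F hFL hF
  by_contra! hcard
  obtain ⟨s, hs⟩ := Multiset.card_pos_iff_exists_mem.1
    ((Nat.choose_pos hcard).trans_eq (Multiset.card_powersetCard (d + 1) _).symm)
  obtain ⟨hs, hsd⟩ := Multiset.mem_powersetCard.1 hs
  obtain ⟨M, hM, hsM⟩ :=
    exists_le_ker_aeval_card_le_finrank hF (hs.trans (Multiset.filter_le _ _))
  have hle := h hFL s hsd (fun a ha => (Multiset.mem_filter.1 (Multiset.mem_of_le hs ha)).2) M hM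
  omega

end EigenvalueStability

section EigenvalueSum

open Module Filter

theorem sum_map_norm_rpow_nonneg (p : ℝ) (s : Multiset ℂ) : 0 ≤ (s.map fun μ => ‖μ‖ ^ p).sum :=
  Multiset.sum_nonneg <| Multiset.forall_mem_map_iff.2 fun μ _ => Real.rpow_nonneg (norm_nonneg μ) p

theorem sum_map_enorm_rpow {p : ℝ} (hp : 0 ≤ p) (s : Multiset ℂ) :
    (s.map fun μ => ‖μ‖ₑ ^ p).sum = ENNReal.ofReal (s.map fun μ => ‖μ‖ ^ p).sum := by
  induction s using Multiset.induction with
  | empty => simp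
  | cons a s ih =>
    simp only [Multiset.map_cons, Multiset.sum_cons]
    rw [ih, ENNReal.ofReal_add (by positivity) (sum_map_norm_rpow_nonneg p s),
      ← ENNReal.ofReal_rpow_of_nonneg (norm_nonneg _) hp, ofReal_norm]

theorem toReal_sum_map_enorm_rpow {p : ℝ} (hp : 0 ≤ p) (s : Multiset ℂ) :
    (s.map fun μ => ‖μ‖ₑ ^ p).sum.toReal = (s.map fun μ => ‖μ‖ ^ p).sum := by
  rw [sum_map_enorm_rpow hp, ENNReal.toReal_ofReal (sum_map_norm_rpow_nonneg p s)]

theorem sum_map_le_sum_map_of_le {α : Type*} (f : α → ℝ≥0∞) {s t : Multiset α} (h : s ≤ t) :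
    (s.map f).sum ≤ (t.map f).sum := by
  obtain ⟨u, rfl⟩ := Multiset.le_iff_exists_add.1 h
  rw [Multiset.map_add, Multiset.sum_add]
  exact le_self_add

open Classical in
theorem sum_map_le_sum_sum_map_filter {α ι : Type*} (f : α → ℝ≥0∞) {t : Finset ι} {U : ι → Set α}
    {s : Multiset α} (hs : ∀ a ∈ s, ∃ i ∈ t, a ∈ U i) :
    (s.map f).sum ≤ ∑ i ∈ t, ((s.filter (· ∈ U i)).map f).sum := by
  induction s using Multiset.induction with
  | empty => simp
  | cons a s ih =>
    obtain ⟨i, hi, ha⟩ := hs a (Multiset.mem_cons_self a s)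
    have hfa : f a ≤ ∑ i ∈ t, if a ∈ U i then f a else 0 := by
      refine (Finset.single_le_sum_of_canonicallyOrdered hi).trans' ?_
      rw [if_pos ha]
    rw [Multiset.map_cons, Multiset.sum_cons]
    refine (add_le_add hfa (ih fun b hb => hs b (Multiset.mem_cons_of_mem hb))).trans_eq ?_
    rw [← Finset.sum_add_distrib]
    refine Finset.sum_congr rfl fun i _ => ?_
    rw [Multiset.filter_cons]
    split_ifs <;> simp

variable {X : Type*} [NormedAddCommGroup X] [NormedSpace ℂ X]

open Classical in
theorem exists_mem_nhds_eventually_sum_filter_le {p : ℝ} (hp : 0 < p) {L : X →L[ℂ] X}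
    (hL : IsCompactOperator L) {c : ℝ≥0∞} (hc : 1 < c) {μ : ℂ} (hμ : μ ≠ 0) :
    ∃ U ∈ 𝓝 μ, ∀ᶠ F : X →L[ℂ] X in 𝓝 L, IsFiniteRank F →
      (((nonzeroEigenvalues F).filter (· ∈ U)).map fun ν => ‖ν‖ₑ ^ p).sum ≤
        c * (finrank ℂ (genEigenspaceOf L μ) * ‖μ‖ₑ ^ p) := by
  obtain ⟨U, hU, hcard⟩ := exists_mem_nhds_eventually_card_filter_le hL hμ
  have hlt : ‖μ‖ₑ ^ p < c * ‖μ‖ₑ ^ p := by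
    have hpos : 0 < ‖μ‖ₑ ^ p := ENNReal.rpow_pos (enorm_pos.2 hμ) enorm_ne_top
    have htop : ‖μ‖ₑ ^ p ≠ ∞ := ENNReal.rpow_ne_top_of_nonneg hp.le enorm_ne_top
    simpa only [one_mul] using (ENNReal.mul_lt_mul_iff_left hpos.ne' htop).2 hc
  have hcont : ∀ᶠ ν in 𝓝 μ, ‖ν‖ₑ ^ p < c * ‖μ‖ₑ ^ p :=
    (Continuous.tendsto (by fun_prop) μ).eventually_lt_const hlt
  obtain ⟨V, hV, hVU⟩ := (hcont.and hU).exists_mem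
  refine ⟨V, hV, hcard.mono fun F hF hFr => ?_⟩
  calc (((nonzeroEigenvalues F).filter (· ∈ V)).map fun ν => ‖ν‖ₑ ^ p).sum
      ≤ ((nonzeroEigenvalues F).filter (· ∈ V)).card * (c * ‖μ‖ₑ ^ p) := by
        rw [← Multiset.card_map fun ν : ℂ => ‖ν‖ₑ ^ p, ← nsmul_eq_mul]
        refine Multiset.sum_le_card_nsmul _ _ (Multiset.forall_mem_map_iff.2 fun ν hν => ?_)
        exact (hVU ν (Multiset.mem_filter.1 hν).2).1.le
    _ ≤ finrank ℂ (genEigenspaceOf L μ) * (c * ‖μ‖ₑ ^ p) := by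
        gcongr
        refine (Multiset.card_le_card ?_).trans (hF hFr)
        exact Multiset.monotone_filter_right _ fun ν hν => (hVU ν hν).2
    _ = c * (finrank ℂ (genEigenspaceOf L μ) * ‖μ‖ₑ ^ p) := mul_left_comm _ _ _

variable [CompleteSpace X]

theorem eigenvalueSum_eq_sum {p : ℝ} (hp : 0 < p) {F : X →L[ℂ] X} (hF : IsFiniteRank F) :
    eigenvalueSum p F = ((nonzeroEigenvalues F).map fun μ => ‖μ‖ₑ ^ p).sum := by
  classical
  rw [eigenvalueSum, tsum_subtype (discreteSpectrum F)
    (fun μ : ℂ => (finrank ℂ (genEigenspaceOf F μ) : ℝ≥0∞) * ‖μ‖ₑ ^ p),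
    tsum_eq_sum (s := (nonzeroEigenvalues F).toFinset), Finset.sum_multiset_map_count]
  · refine Finset.sum_congr rfl fun μ hμ => ?_
    rw [Multiset.mem_toFinset] at hμ
    have hμ0 := ne_zero_of_mem_nonzeroEigenvalues hμ
    rw [Set.indicator_of_mem (mem_discreteSpectrum hF.isCompactOperator hμ0
      (hasEigenvalue_of_mem_nonzeroEigenvalues hF hμ)), count_nonzeroEigenvalues hF hμ0,
      nsmul_eq_mul]
  · intro μ hμ
    rw [Multiset.mem_toFinset, ← Multiset.count_eq_zero] at hμ
    refine Set.indicator_apply_eq_zero.2 fun _ => ?_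
    rcases eq_or_ne μ 0 with rfl | hμ0
    · simp [hp]
    · rw [count_nonzeroEigenvalues hF hμ0] at hμ
      simp [hμ]

theorem toReal_eigenvalueSum {p : ℝ} (hp : 0 < p) {F : X →L[ℂ] X} (hF : IsFiniteRank F) :
    (eigenvalueSum p F).toReal = ((nonzeroEigenvalues F).map fun μ => ‖μ‖ ^ p).sum := by
  rw [eigenvalueSum_eq_sum hp hF, toReal_sum_map_enorm_rpow hp.le]

theorem sum_finrank_mul_le_eigenvalueSum (p : ℝ) {L : X →L[ℂ] X} (hL : IsCompactOperator L)
    {t : Finset ℂ} (ht : ∀ μ ∈ t, μ ≠ 0) :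
    ∑ μ ∈ t, (finrank ℂ (genEigenspaceOf L μ) : ℝ≥0∞) * ‖μ‖ₑ ^ p ≤ eigenvalueSum p L := by
  calc ∑ μ ∈ t, (finrank ℂ (genEigenspaceOf L μ) : ℝ≥0∞) * ‖μ‖ₑ ^ p
      ≤ ∑ μ ∈ t, (discreteSpectrum L).indicator
          (fun μ => (finrank ℂ (genEigenspaceOf L μ) : ℝ≥0∞) * ‖μ‖ₑ ^ p) μ := by
        refine Finset.sum_le_sum fun μ hμ => ?_
        by_cases hbot : genEigenspaceOf L μ = ⊥
        · rw [hbot, finrank_bot, Nat.cast_zero, zero_mul]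
          exact zero_le
        · have hev : End.HasEigenvalue (L : X →ₗ[ℂ] X) μ := End.HasUnifEigenvalue.lt one_pos hbot
          rw [Set.indicator_of_mem (mem_discreteSpectrum hL (ht μ hμ) hev)]
    _ ≤ ∑' μ, (discreteSpectrum L).indicator
          (fun μ => (finrank ℂ (genEigenspaceOf L μ) : ℝ≥0∞) * ‖μ‖ₑ ^ p) μ :=
        ENNReal.sum_le_tsum _
    _ = eigenvalueSum p L := (tsum_subtype _ _).symm

theorem eventually_sum_filter_le_mul_eigenvalueSum {p : ℝ} (hp : 0 < p) {L : X →L[ℂ] X}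
    (hL : IsCompactOperator L) {ρ : ℝ} (hρ : 0 < ρ) {c : ℝ≥0∞} (hc : 1 < c) :
    ∀ᶠ F : X →L[ℂ] X in 𝓝 L, IsFiniteRank F →
      (((nonzeroEigenvalues F).filter fun μ => ρ ≤ ‖μ‖).map fun μ => ‖μ‖ₑ ^ p).sum ≤
        c * eigenvalueSum p L := by
  classical
  choose! U hU hsum using fun μ : ℂ => exists_mem_nhds_eventually_sum_filter_le hp hL hc (μ := μ)
  let A : Set ℂ := Metric.closedBall 0 (‖L‖ + 1) \ Metric.ball 0 ρ
  have hA0 : ∀ μ ∈ A, μ ≠ 0 := by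
    rintro μ hμ rfl
    exact hμ.2 (Metric.mem_ball_self hρ)
  obtain ⟨t, htA, hcover⟩ := ((isCompact_closedBall _ _).diff Metric.isOpen_ball).elim_nhds_subcover
    U fun μ hμ => hU μ (hA0 μ hμ)
  filter_upwards [(t.eventually_all).2 fun μ hμ => hsum μ (hA0 μ (htA μ hμ)),
    Metric.ball_mem_nhds L one_pos] with F hF hFL hFr
  have hmem : ∀ ν ∈ (nonzeroEigenvalues F).filter fun μ => ρ ≤ ‖μ‖, ∃ μ ∈ t, ν ∈ U μ := by
    intro ν hν
    rw [Multiset.mem_filter] at hν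
    have hνL : ‖ν‖ ≤ ‖L‖ + 1 :=
      (norm_le_opNorm_of_hasEigenvalue (hasEigenvalue_of_mem_nonzeroEigenvalues hFr hν.1)).trans
        (norm_le_norm_add_const_of_dist_le (Metric.mem_ball.1 hFL).le)
    obtain ⟨μ, hμ, hνμ⟩ := Set.mem_iUnion₂.1 (hcover ⟨mem_closedBall_zero_iff.2 hνL,
      fun h => (mem_ball_zero_iff.1 h).not_ge hν.2⟩)
    exact ⟨μ, hμ, hνμ⟩
  calc _ ≤ ∑ μ ∈ t, ((((nonzeroEigenvalues F).filter fun μ => ρ ≤ ‖μ‖).filter (· ∈ U μ)).map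
        fun μ => ‖μ‖ₑ ^ p).sum := sum_map_le_sum_sum_map_filter _ hmem
    _ ≤ ∑ μ ∈ t, c * (finrank ℂ (genEigenspaceOf L μ) * ‖μ‖ₑ ^ p) := by
      refine Finset.sum_le_sum fun μ hμ => (sum_map_le_sum_map_of_le _ ?_).trans (hF μ hμ hFr)
      exact Multiset.filter_le_filter _ (Multiset.filter_le _ _)
    _ ≤ c * eigenvalueSum p L := by
      rw [← Finset.mul_sum]
      gcongr
      exact sum_finrank_mul_le_eigenvalueSum p hL fun μ hμ => hA0 μ (htA μ hμ)

theorem eventually_sum_filter_le_toReal_eigenvalueSum_add {p : ℝ} (hp : 0 < p) {L : X →L[ℂ] X}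
    (hL : IsCompactOperator L) (hfin : eigenvalueSum p L ≠ ∞) {ρ : ℝ} (hρ : 0 < ρ) {ε : ℝ}
    (hε : 0 < ε) :
    ∀ᶠ F : X →L[ℂ] X in 𝓝 L, IsFiniteRank F →
      (((nonzeroEigenvalues F).filter fun μ => ρ ≤ ‖μ‖).map fun μ => ‖μ‖ ^ p).sum ≤
        (eigenvalueSum p L).toReal + ε := by
  set S := (eigenvalueSum p L).toReal
  have : 0 ≤ S := ENNReal.toReal_nonneg
  have hc : 1 < ENNReal.ofReal (1 + ε / (S + 1)) :=
    ENNReal.one_lt_ofReal.2 (lt_add_of_pos_right 1 (by positivity))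
  filter_upwards [eventually_sum_filter_le_mul_eigenvalueSum hp hL hρ hc] with F hF hFr
  have h := ENNReal.toReal_mono (ENNReal.mul_ne_top ENNReal.ofReal_ne_top hfin) (hF hFr)
  rw [toReal_sum_map_enorm_rpow hp.le, ENNReal.toReal_mul,
    ENNReal.toReal_ofReal (by positivity)] at h
  calc _ ≤ (1 + ε / (S + 1)) * S := h
    _ = S + ε * (S / (S + 1)) := by ring
    _ ≤ S + ε * 1 := by
        gcongr
        exact div_le_one_of_le₀ (lt_add_one S).le (by positivity)
    _ = S + ε := by rw [mul_one]

end EigenvalueSum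

section WeierstrassFactor

/-- The Weierstrass factor `E_m(u) = (1 - u) exp (∑_{0 < k < m} u ^ k / k)`, indexed so that
`det_p (I - F)` is the product of `E_m(μ)` over the eigenvalues `μ` of `F` with `m = ⌈p⌉`. -/
noncomputable def weierstrassFactor (m : ℕ) (u : ℂ) : ℂ :=
  (1 - u) * Complex.exp (∑ k ∈ Finset.Ico 1 m, (1 / (k : ℂ)) * u ^ k)

theorem weierstrassFactor_succ {m : ℕ} (hm : 1 ≤ m) (u : ℂ) :
    weierstrassFactor (m + 1) u = weierstrassFactor m u * Complex.exp ((1 / (m : ℂ)) * u ^ m) := by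
  rw [weierstrassFactor, weierstrassFactor, Finset.sum_Ico_succ_top hm, Complex.exp_add, mul_assoc]

theorem logTaylor_neg (n : ℕ) (u : ℂ) :
    Complex.logTaylor (n + 1) (-u) = -∑ k ∈ Finset.Ico 1 (n + 1), (1 / (k : ℂ)) * u ^ k := by
  rw [Complex.logTaylor, Finset.sum_range_eq_add_Ico _ n.succ_pos, ← Finset.sum_neg_distrib]
  simp only [Nat.cast_zero, div_zero, zero_add]
  refine Finset.sum_congr rfl fun k _ => ?_
  rw [neg_pow u k, pow_succ, mul_neg_one, neg_mul, ← mul_assoc, ← pow_add, ← two_mul, pow_mul]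
  simp [div_eq_inv_mul]

theorem weierstrassFactor_eq_exp_log_sub_logTaylor (n : ℕ) {u : ℂ} (hu : ‖u‖ < 1) :
    weierstrassFactor (n + 1) u =
      Complex.exp (Complex.log (1 + -u) - Complex.logTaylor (n + 1) (-u)) := by
  have h1u : 1 + -u ≠ 0 := by
    rw [← sub_eq_add_neg, sub_ne_zero]
    rintro rfl
    exact hu.ne norm_one
  rw [logTaylor_neg, sub_neg_eq_add, Complex.exp_add, Complex.exp_log h1u, ← sub_eq_add_neg,
    weierstrassFactor]

theorem norm_weierstrassFactor_le_of_norm_le_half {m : ℕ} (hm : 1 ≤ m) {u : ℂ}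
    (hu : ‖u‖ ≤ 1 / 2) : ‖weierstrassFactor m u‖ ≤ Real.exp (2 * ‖u‖ ^ m) := by
  obtain ⟨n, rfl⟩ := Nat.exists_eq_add_of_le' hm
  have hu1 : ‖u‖ < 1 := by linarith
  have hlog := Complex.norm_log_sub_logTaylor_le n (z := -u) (by rwa [norm_neg])
  rw [weierstrassFactor_eq_exp_log_sub_logTaylor n hu1]
  refine (Complex.norm_exp_le_exp_norm _).trans (Real.exp_le_exp.2 (hlog.trans ?_))
  have hinv : (1 - ‖u‖)⁻¹ ≤ 2 := by
    rw [inv_le_comm₀ (by linarith) (by norm_num)]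
    linarith
  calc ‖-u‖ ^ (n + 1) * (1 - ‖-u‖)⁻¹ / (n + 1) ≤ ‖u‖ ^ (n + 1) * 2 / 1 := by
        rw [norm_neg]
        gcongr
        linarith [(Nat.cast_nonneg n : (0 : ℝ) ≤ n)]
    _ = 2 * ‖u‖ ^ (n + 1) := by ring

theorem pow_ceil_le_rpow {p x : ℝ} (hp : 0 < p) (hx : 0 ≤ x) (hx1 : x ≤ 1) :
    x ^ ⌈p⌉₊ ≤ x ^ p := by
  rcases hx.eq_or_lt with rfl | hx0
  · rw [zero_pow (Nat.ceil_pos.2 hp).ne', Real.zero_rpow hp.ne']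
  · rw [← Real.rpow_natCast]
    exact Real.rpow_le_rpow_of_exponent_ge hx0 hx1 (Nat.le_ceil p)

theorem norm_one_sub_le_exp_rpow {p : ℝ} (hp : 0 < p) {u : ℂ} (hu : 1 / 2 < ‖u‖) :
    ‖1 - u‖ ≤ Real.exp (3 ^ p / p * ‖u‖ ^ p) :=
  calc ‖1 - u‖ ≤ 1 + ‖u‖ := by simpa using norm_sub_le 1 u
    _ ≤ 3 * ‖u‖ := by linarith
    _ = Real.exp (Real.log (3 * ‖u‖)) := (Real.exp_log (by linarith)).symm
    _ ≤ Real.exp ((3 * ‖u‖) ^ p / p) :=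
      Real.exp_le_exp.2 (Real.log_le_rpow_div (by positivity) hp)
    _ = Real.exp (3 ^ p / p * ‖u‖ ^ p) := by
      rw [Real.mul_rpow (by norm_num) (norm_nonneg u), mul_div_right_comm]

theorem norm_pow_div_le_rpow {p : ℝ} {u : ℂ} (hu : 1 / 2 < ‖u‖) {k : ℕ} (hk : 1 ≤ k)
    (hkp : k ≤ p) : ‖(1 / (k : ℂ)) * u ^ k‖ ≤ 2 ^ p * ‖u‖ ^ p := by
  have hk1 : (1 : ℝ) ≤ k := by exact_mod_cast hk
  calc ‖(1 / (k : ℂ)) * u ^ k‖ = 1 / k * ‖u‖ ^ k := by simp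
    _ ≤ 1 * ‖u‖ ^ k := by
      gcongr
      exact (div_le_one (by linarith)).2 hk1
    _ ≤ 2 ^ k * ‖u‖ ^ k := by
      gcongr
      exact one_le_pow₀ (by norm_num)
    _ = (2 * ‖u‖) ^ (k : ℝ) := by rw [Real.rpow_natCast, mul_pow]
    _ ≤ (2 * ‖u‖) ^ p := Real.rpow_le_rpow_of_exponent_le (by linarith) hkp
    _ = 2 ^ p * ‖u‖ ^ p := Real.mul_rpow (by norm_num) (norm_nonneg u)

theorem norm_sum_pow_div_le_rpow {p : ℝ} {u : ℂ} (hu : 1 / 2 < ‖u‖) :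
    ‖∑ k ∈ Finset.Ico 1 ⌈p⌉₊, (1 / (k : ℂ)) * u ^ k‖ ≤ ⌈p⌉₊ * 2 ^ p * ‖u‖ ^ p :=
  calc ‖∑ k ∈ Finset.Ico 1 ⌈p⌉₊, (1 / (k : ℂ)) * u ^ k‖
      ≤ ∑ k ∈ Finset.Ico 1 ⌈p⌉₊, 2 ^ p * ‖u‖ ^ p := norm_sum_le_of_le _ fun k hk =>
        have hk := Finset.mem_Ico.1 hk
        norm_pow_div_le_rpow hu hk.1 (Nat.lt_ceil.1 hk.2).le
    _ ≤ ⌈p⌉₊ * 2 ^ p * ‖u‖ ^ p := by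
      rw [Finset.sum_const, nsmul_eq_mul, Nat.card_Ico, mul_assoc]
      gcongr
      exact Nat.sub_le _ _

theorem exists_norm_weierstrassFactor_le {p : ℝ} (hp : 0 < p) :
    ∃ Γ > 0, ∀ u : ℂ, ‖weierstrassFactor ⌈p⌉₊ u‖ ≤ Real.exp (Γ * ‖u‖ ^ p) := by
  refine ⟨3 ^ p / p + ⌈p⌉₊ * 2 ^ p + 2, by positivity, fun u => ?_⟩
  rcases le_or_gt ‖u‖ (1 / 2) with hu | hu
  · refine (norm_weierstrassFactor_le_of_norm_le_half (Nat.one_le_ceil_iff.2 hp) hu).trans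
      (Real.exp_le_exp.2 ?_)
    have hpow := pow_ceil_le_rpow hp (norm_nonneg u) (by linarith)
    have hrest : 0 ≤ (3 ^ p / p + ⌈p⌉₊ * 2 ^ p) * ‖u‖ ^ p := by positivity
    linarith
  · calc ‖weierstrassFactor ⌈p⌉₊ u‖
        = ‖1 - u‖ * ‖Complex.exp (∑ k ∈ Finset.Ico 1 ⌈p⌉₊, (1 / (k : ℂ)) * u ^ k)‖ :=
          norm_mul _ _
      _ ≤ Real.exp (3 ^ p / p * ‖u‖ ^ p) * Real.exp (⌈p⌉₊ * 2 ^ p * ‖u‖ ^ p) := by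
        gcongr
        · exact norm_one_sub_le_exp_rpow hp hu
        · exact (Complex.norm_exp_le_exp_norm _).trans
            (Real.exp_le_exp.2 (norm_sum_pow_div_le_rpow hu))
      _ ≤ Real.exp ((3 ^ p / p + ⌈p⌉₊ * 2 ^ p + 2) * ‖u‖ ^ p) := by
        rw [← Real.exp_add, Real.exp_le_exp]
        have : 0 ≤ 2 * ‖u‖ ^ p := by positivity
        linarith

theorem sum_nthRootsFinset_pow_eq_zero {m k : ℕ} (hk : 0 < k) (hkm : k < m) :
    ∑ ω ∈ Polynomial.nthRootsFinset m (1 : ℂ), ω ^ k = 0 := by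
  have hm : 0 < m := hk.trans hkm
  have hζ := Complex.isPrimitiveRoot_exp m hm.ne'
  set ζ := Complex.exp (2 * Real.pi * Complex.I / m)
  have hζm {ω : ℂ} (hω : ω ∈ Polynomial.nthRootsFinset m (1 : ℂ)) :
      ζ * ω ∈ Polynomial.nthRootsFinset m (1 : ℂ) := by
    simpa using Polynomial.mul_mem_nthRootsFinset (hζ.mem_nthRootsFinset hm) hω
  have hinj : Set.InjOn (ζ * ·) (Polynomial.nthRootsFinset m (1 : ℂ) : Set ℂ) :=
    (mul_right_injective₀ (hζ.ne_zero hm.ne')).injOn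
  have hrot : ∑ ω ∈ Polynomial.nthRootsFinset m (1 : ℂ), (ζ * ω) ^ k =
      ∑ ω ∈ Polynomial.nthRootsFinset m (1 : ℂ), ω ^ k :=
    Finset.sum_nbij (ζ * ·) (fun _ => hζm) hinj
      (Finset.surjOn_of_injOn_of_card_le _ (fun _ => hζm) hinj le_rfl) fun _ _ => rfl
  simp_rw [mul_pow, ← Finset.mul_sum] at hrot
  exact (mul_left_eq_self₀.1 hrot).resolve_left (hζ.pow_ne_one_of_pos_of_lt hk.ne' hkm)

theorem prod_weierstrassFactor_nthRootsFinset {m : ℕ} (hm : 0 < m) (u : ℂ) :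
    ∏ ω ∈ Polynomial.nthRootsFinset m (1 : ℂ), weierstrassFactor m (ω * u) = 1 - u ^ m := by
  have hsum : ∑ k ∈ Finset.Ico 1 m, ∑ ω ∈ Polynomial.nthRootsFinset m (1 : ℂ),
      1 / (k : ℂ) * (ω * u) ^ k = 0 := by
    refine Finset.sum_eq_zero fun k hk => ?_
    simp_rw [mul_pow, mul_comm _ (u ^ k), ← mul_assoc, ← Finset.mul_sum]
    rw [sum_nthRootsFinset_pow_eq_zero (Finset.mem_Ico.1 hk).1 (Finset.mem_Ico.1 hk).2, mul_zero]
  simp only [weierstrassFactor]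
  rw [Finset.prod_mul_distrib, ← Complex.exp_sum, Finset.sum_comm, hsum, Complex.exp_zero, mul_one,
    ← (Complex.isPrimitiveRoot_exp m hm.ne').pow_sub_pow_eq_prod_sub_mul 1 u hm, one_pow]

end WeierstrassFactor

section ComplexAnalysis

open Metric

theorem norm_le_of_forall_norm_eq {f : ℂ → ℂ} (hf : Differentiable ℂ f) {R C : ℝ} (hR : 0 < R)
    (hC : ∀ w : ℂ, ‖w‖ = R → ‖f w‖ ≤ C) {w : ℂ} (hw : ‖w‖ ≤ R) : ‖f w‖ ≤ C := by
  refine Complex.norm_le_of_forall_mem_frontier_norm_le (U := ball (0 : ℂ) R) isBounded_ball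
    hf.diffContOnCl (fun z hz => hC z ?_) ?_
  · rwa [frontier_ball _ hR.ne', mem_sphere_zero_iff_norm] at hz
  · rwa [closure_ball _ hR.ne', mem_closedBall_zero_iff]

theorem norm_deriv_zero_le_of_re_le {g : ℂ → ℂ} {R M : ℝ} (hR : 0 < R) (hM : 0 < M)
    (hg : DifferentiableOn ℂ g (ball 0 R)) (hg0 : g 0 = 0)
    (hre : ∀ w ∈ ball (0 : ℂ) R, (g w).re ≤ M) : ‖deriv g 0‖ ≤ 4 * M / R := by
  have hbd : ∀ w ∈ sphere (0 : ℂ) (R / 2), ‖g w‖ ≤ 2 * M := by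
    intro w hw
    rw [mem_sphere_zero_iff_norm] at hw
    refine (Complex.borelCaratheodory_zero hM hg hre hR
      (by rw [mem_ball_zero_iff, hw]; linarith) hg0).trans_eq ?_
    rw [hw]
    field_simp
    norm_num
  refine (Complex.norm_deriv_le_of_forall_mem_sphere_norm_le (half_pos hR)
    ((hg.mono (closedBall_subset_ball (half_lt_self hR))).diffContOnCl_ball subset_rfl)
    hbd).trans_eq ?_
  field_simp
  norm_num

section LogProduct

variable {ι : Type*} [Fintype ι] {a : ι → ℂ}

theorem one_sub_mem_slitPlane {u : ℂ} (hu : ‖u‖ < 1) : 1 - u ∈ Complex.slitPlane := by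
  rw [sub_eq_add_neg]
  exact Complex.mem_slitPlane_of_norm_lt_one (by rwa [norm_neg])

theorem hasDerivAt_sum_log_one_sub_mul {w : ℂ} (hw : ∀ i, ‖w * a i‖ < 1) :
    HasDerivAt (fun w => ∑ i, Complex.log (1 - w * a i)) (∑ i, -a i / (1 - w * a i)) w := by
  refine HasDerivAt.fun_sum fun i _ => HasDerivAt.clog ?_ (one_sub_mem_slitPlane (hw i))
  simpa using ((hasDerivAt_id w).mul_const (a i)).const_sub 1

theorem exp_sum_log_one_sub_mul {w : ℂ} (hw : ∀ i, ‖w * a i‖ < 1) :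
    Complex.exp (∑ i, Complex.log (1 - w * a i)) = ∏ i, (1 - w * a i) := by
  rw [Complex.exp_sum]
  exact Finset.prod_congr rfl fun i _ =>
    Complex.exp_log (Complex.slitPlane_ne_zero (one_sub_mem_slitPlane (hw i)))

theorem norm_sum_le_of_norm_prod_le {R M : ℝ} (hR : 0 < R) (hM : 0 < M)
    (ha : ∀ i, ‖a i‖ * R ≤ 2)
    (hprod : ∀ w : ℂ, ‖w‖ = R → ‖∏ i, (1 - w * a i)‖ ≤ Real.exp M) :
    ‖∑ i, a i‖ ≤ 8 * M / R := by
  have hsmall : ∀ w ∈ ball (0 : ℂ) (R / 2), ∀ i, ‖w * a i‖ < 1 := by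
    intro w hw i
    rw [mem_ball_zero_iff] at hw
    rw [norm_mul]
    nlinarith [norm_nonneg (a i), norm_nonneg w, ha i]
  have hre : ∀ w ∈ ball (0 : ℂ) (R / 2), (∑ i, Complex.log (1 - w * a i)).re ≤ M := by
    intro w hw
    have hwR : ‖w‖ ≤ R := by
      rw [mem_ball_zero_iff] at hw
      linarith
    have hle := norm_le_of_forall_norm_eq (f := fun w => ∏ i, (1 - w * a i)) (by fun_prop) hR
      hprod hwR
    rwa [← exp_sum_log_one_sub_mul (hsmall w hw), Complex.norm_exp, Real.exp_le_exp] at hle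
  have hderiv := norm_deriv_zero_le_of_re_le (half_pos hR) hM
    (fun w hw => (hasDerivAt_sum_log_one_sub_mul
      (hsmall w hw)).differentiableAt.differentiableWithinAt) (by simp) hre
  rw [(hasDerivAt_sum_log_one_sub_mul (hsmall 0 (mem_ball_self (half_pos hR)))).deriv] at hderiv
  simp only [zero_mul, sub_zero, div_one, Finset.sum_neg_distrib, norm_neg] at hderiv
  refine hderiv.trans_eq ?_
  field_simp
  norm_num

end LogProduct

theorem eval_reflect_inv_mul_pow {P : Polynomial ℂ} {r : ℕ} (hP : P.natDegree ≤ r) {t : ℂ}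
    (ht : t ≠ 0) : (P.reflect r).eval t⁻¹ * t ^ r = P.eval t := by
  have := invertibleOfNonzero ht
  simpa using Polynomial.eval₂_reflect_mul_pow (RingHom.id ℂ) t r P hP

theorem norm_eval_le_mul_norm_pow {P : Polynomial ℂ} {r : ℕ} (hP : P.natDegree ≤ r) {M : ℝ}
    (hM : ∀ t : ℂ, ‖t‖ = 1 → ‖P.eval t‖ ≤ M) {t : ℂ} (ht : 1 ≤ ‖t‖) :
    ‖P.eval t‖ ≤ M * ‖t‖ ^ r := by
  have hcircle : ∀ z : ℂ, ‖z‖ = 1 → ‖(P.reflect r).eval z‖ ≤ M := by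
    intro z hz
    have hz0 : z⁻¹ ≠ 0 := inv_ne_zero (norm_pos_iff.1 (hz ▸ one_pos))
    have hinv := hM z⁻¹ (by rw [norm_inv, hz, inv_one])
    rw [← eval_reflect_inv_mul_pow hP hz0, inv_inv, norm_mul, norm_pow, norm_inv, hz] at hinv
    simpa using hinv
  rw [← eval_reflect_inv_mul_pow hP (norm_pos_iff.1 (one_pos.trans_le ht)), norm_mul, norm_pow]
  gcongr
  refine norm_le_of_forall_norm_eq (Polynomial.differentiable _) one_pos hcircle ?_
  rw [norm_inv]
  exact inv_le_one_of_one_le₀ ht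

theorem norm_sub_le_of_norm_le {f : ℂ → ℂ} (hf : Differentiable ℂ f) {r M : ℝ} (hr : 0 < r)
    (hM : ∀ z : ℂ, ‖z‖ ≤ 1 / 2 + r → ‖f z‖ ≤ M) : ‖f (1 / 2) - f (-(1 / 2))‖ ≤ M / r := by
  have hderiv : ∀ z ∈ closedBall (0 : ℂ) (1 / 2), ‖deriv f z‖ ≤ M / r := by
    intro z hz
    rw [mem_closedBall_zero_iff] at hz
    refine Complex.norm_deriv_le_of_forall_mem_sphere_norm_le hr hf.diffContOnCl fun w hw =>
      hM w ?_
    rw [mem_sphere_iff_norm] at hw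
    linarith [norm_le_norm_add_norm_sub' w z]
  have hmv := (convex_closedBall (0 : ℂ) (1 / 2)).norm_image_sub_le_of_norm_deriv_le
    (fun z _ => hf.differentiableAt) hderiv (x := -(1 / 2)) (y := 1 / 2) (by simp) (by simp)
  have hlength : ‖(1 / 2 : ℂ) - -(1 / 2)‖ = 1 := by norm_num
  rwa [hlength, mul_one] at hmv

end ComplexAnalysis

section GrowthConstant

open Module

variable {X : Type u} [NormedAddCommGroup X] [NormedSpace ℂ X]

theorem regDet_eq_prod (p : ℝ) {F : X →L[ℂ] X} (hF : IsFiniteRank F) :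
    regDet p F = ((nonzeroEigenvalues F).map (weierstrassFactor ⌈p⌉₊)).prod := by
  have htrace : ∀ k ∈ Finset.Ico 1 ⌈p⌉₊, 1 / (k : ℂ) * finTrace (F ^ k) =
      ((nonzeroEigenvalues F).map fun u => 1 / (k : ℂ) * u ^ k).sum := by
    intro k hk
    rw [finTrace_pow_eq_sum hF (Nat.one_le_iff_ne_zero.1 (Finset.mem_Ico.1 hk).1),
      Multiset.sum_map_mul_left]
  rw [regDet, detOneSub_eq_prod hF, Finset.sum_congr rfl htrace,
    Finset.sum_eq_multiset_sum, Multiset.sum_map_sum_map, Complex.exp_multiset_sum,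
    Multiset.map_map, ← Multiset.prod_map_mul]
  rfl

theorem norm_prod_map_le_exp {α : Type*} {g : α → ℂ} {c : α → ℝ} (s : Multiset α)
    (h : ∀ u ∈ s, ‖g u‖ ≤ Real.exp (c u)) :
    ‖(s.map g).prod‖ ≤ Real.exp (s.map c).sum := by
  induction s using Multiset.induction with
  | empty => simp
  | cons a s ih =>
    rw [Multiset.map_cons, Multiset.prod_cons, Multiset.map_cons, Multiset.sum_cons, Real.exp_add,
      norm_mul]
    gcongr
    · exact h a (Multiset.mem_cons_self _ _)
    · exact ih fun u hu => h u (Multiset.mem_cons_of_mem hu)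

theorem exists_map_univ_fin_eq {α : Type*} (s : Multiset α) {k : ℕ} (h : s.card = k) :
    ∃ f : Fin k → α, Finset.univ.val.map f = s := by
  subst h
  induction s using Quotient.inductionOn with
  | h l => exact ⟨l.get, (Fin.univ_val_map l.get).trans (congrArg _ (List.ofFn_get l))⟩

theorem exists_roots_charpoly_eq {K V : Type*} [Field K] [AddCommGroup V] [Module K V]
    [FiniteDimensional K V] {s : Multiset K} (hs : s.card = finrank K V) :
    ∃ T : End K V, T.charpoly.roots = s := by
  obtain ⟨d, rfl⟩ := exists_map_univ_fin_eq s hs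
  refine ⟨Matrix.toLin (finBasis K V) (finBasis K V) (Matrix.diagonal d), ?_⟩
  rw [← LinearMap.charpoly_toMatrix _ (finBasis K V), LinearMap.toMatrix_toLin,
    Matrix.charpoly_diagonal]
  have hroots := Polynomial.roots_multiset_prod_X_sub_C (Finset.univ.val.map d)
  rwa [Multiset.map_map] at hroots

theorem exists_restrictTo_eq (V : Submodule ℂ X) [FiniteDimensional ℂ V] (T : End ℂ V) :
    ∃ (G : X →L[ℂ] X) (hG : opRange G ≤ V), restrictTo G V hG = T := by
  obtain ⟨π, hπ⟩ := Submodule.ClosedComplemented.of_finiteDimensional V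
  refine ⟨V.subtypeL ∘L LinearMap.toContinuousLinearMap T ∘L π, ?_, ?_⟩
  · rintro _ ⟨x, rfl⟩
    exact (T (π x)).2
  · ext x
    simp [restrictTo, hπ]

theorem exists_isFiniteRank_nonzeroEigenvalues_eq (V : Submodule ℂ X) [FiniteDimensional ℂ V]
    {t : Multiset ℂ} (ht : ∀ μ ∈ t, μ ≠ 0) (hcard : t.card ≤ finrank ℂ V) :
    ∃ G : X →L[ℂ] X, IsFiniteRank G ∧ nonzeroEigenvalues G = t := by
  obtain ⟨T, hT⟩ := exists_roots_charpoly_eq (V := V)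
    (s := t + Multiset.replicate (finrank ℂ V - t.card) 0) (by simp; omega)
  obtain ⟨G, hG, hGT⟩ := exists_restrictTo_eq V T
  refine ⟨G, Submodule.finiteDimensional_of_le hG, ?_⟩
  rw [nonzeroEigenvalues_eq_filter_roots hG, hGT, hT, Multiset.filter_add,
    Multiset.filter_eq_self.2 ht, Multiset.filter_eq_nil.2, add_zero]
  intro a ha
  simp [Multiset.eq_of_mem_replicate ha]

variable [CompleteSpace X]

theorem isGrowthConstant_of_norm_weierstrassFactor_le {p Γ : ℝ} (hp : 0 < p) (hΓ : 0 < Γ)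
    (h : ∀ u : ℂ, ‖weierstrassFactor ⌈p⌉₊ u‖ ≤ Real.exp (Γ * ‖u‖ ^ p)) :
    IsGrowthConstant X p Γ := by
  refine ⟨hΓ, fun F hF => ?_⟩
  rw [regDet_eq_prod p hF, toReal_eigenvalueSum hp hF, ← Multiset.sum_map_mul_left]
  exact norm_prod_map_le_exp _ fun u _ => h u

-- Every submultiset of the eigenvalues is itself the spectrum of a finite rank operator.
theorem IsGrowthConstant.norm_prod_le {p Γ : ℝ} (hp : 0 < p) (hΓ : IsGrowthConstant X p Γ)
    {F : X →L[ℂ] X} (hF : IsFiniteRank F) {t : Multiset ℂ} (ht : t ≤ nonzeroEigenvalues F) :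
    ‖(t.map (weierstrassFactor ⌈p⌉₊)).prod‖ ≤ Real.exp (Γ * (t.map fun μ => ‖μ‖ ^ p).sum) := by
  have : FiniteDimensional ℂ (opRange F) := hF
  obtain ⟨G, hG, rfl⟩ := exists_isFiniteRank_nonzeroEigenvalues_eq (opRange F)
    (fun μ hμ => ne_zero_of_mem_nonzeroEigenvalues (Multiset.mem_of_le ht hμ))
    ((Multiset.card_le_card ht).trans (card_nonzeroEigenvalues_le hF))
  rw [← regDet_eq_prod p hG, ← toReal_eigenvalueSum hp hG]
  exact hΓ.2 G hG

end GrowthConstant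

section QuasiNorm

open Filter

variable {V : Type u} [AddCommGroup V] {N : V → ℝ}

/-- `f` is Lipschitz with respect to the quasi-norm `N` on the `N`-bounded subsets of `S`, the
property which carries a function over from a dense subspace to the whole space. -/
def IsLipschitzOnBounded (N : V → ℝ) (S : Set V) (f : V → ℂ) : Prop :=
  ∀ B : ℝ, ∃ C ≥ 0, ∀ x ∈ S, ∀ y ∈ S, N x ≤ B → N y ≤ B → ‖f x - f y‖ ≤ C * N (x - y)

theorem IsLipschitzOnBounded.congr {S : Set V} {f g : V → ℂ} (hf : IsLipschitzOnBounded N S f)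
    (hfg : Set.EqOn f g S) : IsLipschitzOnBounded N S g := fun B =>
  (hf B).imp fun _ h => ⟨h.1, fun x hx y hy => hfg hx ▸ hfg hy ▸ h.2 x hx y hy⟩

variable [Module ℂ V] {q : ℝ}

namespace IsQuasiNorm

theorem map_zero (hN : IsQuasiNorm N q) : N 0 = 0 := (hN.eq_zero_iff 0).2 rfl

theorem pos (hN : IsQuasiNorm N q) : 0 < q := one_pos.trans_le hN.one_le

theorem map_neg (hN : IsQuasiNorm N q) (x : V) : N (-x) = N x := by
  simpa using hN.smul_eq (-1) x

theorem map_sub_rev (hN : IsQuasiNorm N q) (x y : V) : N (x - y) = N (y - x) := by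
  rw [← hN.map_neg, neg_sub]

theorem sub_le (hN : IsQuasiNorm N q) (x y : V) : N (x - y) ≤ q * (N x + N y) := by
  simpa only [hN.map_neg, ← sub_eq_add_neg] using hN.add_le x (-y)

theorem add_smul_le (hN : IsQuasiNorm N q) (x y : V) (z : ℂ) :
    N (x + z • y) ≤ q * (N x + ‖z‖ * N y) :=
  hN.smul_eq z y ▸ hN.add_le x (z • y)

theorem sub_le_sub (hN : IsQuasiNorm N q) (x y z : V) :
    N (x - z) ≤ q * (N (x - y) + N (y - z)) := by
  simpa using hN.add_le (x - y) (y - z)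

theorem le_of_sub_le_one (hN : IsQuasiNorm N q) {x y : V} (h : N (y - x) ≤ 1) :
    N y ≤ q * (1 + N x) := by
  have hq := hN.pos
  calc N y ≤ q * (N (y - x) + N x) := by simpa using hN.add_le (y - x) x
    _ ≤ q * (1 + N x) := by gcongr

theorem tendsto_iff (hN : IsQuasiNorm N q) {α : Type*} {l : Filter α} {u : α → V} {x : V} :
    Tendsto u l (@nhds V (quasiNormTopology N) x) ↔ Tendsto (fun a => N (u a - x)) l (𝓝 0) := by
  have hball : ∀ ε > 0, {y | N (y - x) < ε} ∈ @nhds V (quasiNormTopology N) x := fun ε hε =>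
    (mem_nhds_quasiNormTopology hN x _).2 ⟨ε, hε, fun _ => id⟩
  refine ⟨fun h => ?_, fun h s hs => ?_⟩
  · refine Metric.tendsto_nhds.2 fun ε hε => (h.eventually (hball ε hε)).mono fun a ha => ?_
    rwa [dist_zero_right, Real.norm_of_nonneg (hN.nonneg _)]
  · obtain ⟨ε, hε, hs⟩ := (mem_nhds_quasiNormTopology hN x s).1 hs
    exact (h.eventually_lt_const hε).mono fun a ha => hs _ ha

theorem exists_seq_of_dense (hN : IsQuasiNorm N q) {S : Set V}
    (hS : @Dense V (quasiNormTopology N) S) (x : V) :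
    ∃ u : ℕ → V, (∀ n, u n ∈ S) ∧ Tendsto (fun n => N (u n - x)) atTop (𝓝 0) := by
  let _ := quasiNormTopology N
  have hnear : ∀ n : ℕ, ∃ y ∈ S, N (y - x) < 1 / ((n : ℝ) + 1) := fun n =>
    have hball : {y | N (y - x) < 1 / ((n : ℝ) + 1)} ∈ 𝓝 x :=
      (mem_nhds_quasiNormTopology hN x _).2 ⟨_, by positivity, fun _ => id⟩
    (hS.inter_nhds_nonempty hball).imp fun _ => id
  choose u huS hu using hnear
  exact ⟨u, huS, squeeze_zero (fun n => hN.nonneg _) (fun n => (hu n).le)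
    tendsto_one_div_add_atTop_nhds_zero_nat⟩

theorem add_smul_le_of_sub_le_one (hN : IsQuasiNorm N q) {a b x y : V} {z : ℂ} {r : ℝ}
    (ha : N (a - x) ≤ 1) (hb : N (b - y) ≤ 1) (hz : ‖z‖ ≤ r) :
    N (a + z • b) ≤ q * (q * (1 + N x) + r * (q * (1 + N y))) := by
  have := hN.pos
  have := hN.nonneg b
  have : 0 ≤ r := (norm_nonneg z).trans hz
  refine (hN.add_smul_le a b z).trans ?_
  gcongr
  exacts [hN.le_of_sub_le_one ha, hN.le_of_sub_le_one hb]

end IsQuasiNorm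

/-- `f` is entire along every complex line through a point of `S` in the direction of a vector
of `S`. -/
def IsEntireAlongLines (S : Set V) (f : V → ℂ) : Prop :=
  ∀ x ∈ S, ∀ y ∈ S, Differentiable ℂ fun z : ℂ => f (x + z • y)

/-- `f` grows on `S` at most with order `p` and type `c` with respect to the quasi-norm `N`. -/
def HasExpBound (N : V → ℝ) (p c : ℝ) (S : Set V) (f : V → ℂ) : Prop :=
  ∀ x ∈ S, ‖f x‖ ≤ Real.exp (c * N x ^ p)

theorem IsEntireAlongLines.congr {S : Submodule ℂ V} {f g : V → ℂ} (hf : IsEntireAlongLines S f)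
    (hfg : Set.EqOn f g S) : IsEntireAlongLines S g := fun x hx y hy =>
  (funext fun z => hfg (S.add_mem hx (S.smul_mem z hy))) ▸ hf x hx y hy

theorem IsQuasiNorm.half_add_add_smul_sub_le (hN : IsQuasiNorm N q) {x y : V}
    (hxy : 0 < N (x - y)) {z : ℂ} (hz : ‖z‖ ≤ 1 / 2 + 1 / N (x - y)) :
    N ((1 / 2 : ℂ) • (x + y) + z • (x - y)) ≤ q ^ 2 * (N x + N y + 1) := by
  have hq := hN.pos
  calc N ((1 / 2 : ℂ) • (x + y) + z • (x - y))
      ≤ q * (‖(1 / 2 : ℂ)‖ * N (x + y) + ‖z‖ * N (x - y)) :=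
        hN.smul_eq (1 / 2) (x + y) ▸ hN.add_smul_le _ _ z
    _ ≤ q * (1 / 2 * (q * (N x + N y)) + (1 / 2 + 1 / N (x - y)) * N (x - y)) := by
        gcongr
        · exact hN.nonneg _
        · norm_num
        · exact hN.add_le x y
    _ = q * (1 / 2 * (q * (N x + N y)) + 1 / 2 * N (x - y) + 1) := by
        field_simp
        ring
    _ ≤ q * (1 / 2 * (q * (N x + N y)) + 1 / 2 * (q * (N x + N y)) + q) := by
        gcongr
        · exact hN.sub_le x y
        · exact hN.one_le
    _ = q ^ 2 * (N x + N y + 1) := by ring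

-- Cauchy's estimate on discs of radius `1 / N (x - y)` along the segment from `y` to `x`.
theorem IsEntireAlongLines.norm_sub_le (hN : IsQuasiNorm N q) {S : Submodule ℂ V} {f : V → ℂ}
    {p c : ℝ} (hp : 0 < p) (hc : 0 ≤ c) (hf : IsEntireAlongLines S f)
    (hbound : HasExpBound N p c S f) {x y : V} (hx : x ∈ S) (hy : y ∈ S) :
    ‖f x - f y‖ ≤ N (x - y) * Real.exp (q ^ (2 * p) * c * (N x + N y + 1) ^ p) := by
  rcases (hN.nonneg (x - y)).eq_or_lt with h0 | h0
  · rw [sub_eq_zero.1 ((hN.eq_zero_iff _).1 h0.symm)]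
    simp [hN.map_zero]
  have hmid : (1 / 2 : ℂ) • (x + y) ∈ S := S.smul_mem _ (S.add_mem hx hy)
  have hdir : x - y ∈ S := S.sub_mem hx hy
  have hline : ∀ z : ℂ, ‖z‖ ≤ 1 / 2 + 1 / N (x - y) →
      ‖f ((1 / 2 : ℂ) • (x + y) + z • (x - y))‖ ≤
        Real.exp (q ^ (2 * p) * c * (N x + N y + 1) ^ p) := by
    intro z hz
    refine (hbound _ (S.add_mem hmid (S.smul_mem z hdir))).trans (Real.exp_le_exp.2 ?_)
    have hx0 := hN.nonneg x
    have hy0 := hN.nonneg y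
    have hq0 := hN.pos.le
    calc c * N ((1 / 2 : ℂ) • (x + y) + z • (x - y)) ^ p
        ≤ c * (q ^ 2 * (N x + N y + 1)) ^ p := by
          gcongr
          · exact hN.nonneg _
          · exact hN.half_add_add_smul_sub_le h0 hz
      _ = q ^ (2 * p) * c * (N x + N y + 1) ^ p := by
          rw [Real.mul_rpow (by positivity) (by positivity), Real.rpow_mul hq0, Real.rpow_two]
          ring
  have key := norm_sub_le_of_norm_le (hf _ hmid _ hdir) (one_div_pos.2 h0) hline
  have hxe : (1 / 2 : ℂ) • (x + y) + (1 / 2 : ℂ) • (x - y) = x := by module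
  have hye : (1 / 2 : ℂ) • (x + y) + (-(1 / 2) : ℂ) • (x - y) = y := by module
  rw [hxe, hye] at key
  exact key.trans_eq (by field_simp)

theorem IsEntireAlongLines.isLipschitzOnBounded (hN : IsQuasiNorm N q) {S : Submodule ℂ V}
    {f : V → ℂ} {p c : ℝ} (hp : 0 < p) (hc : 0 ≤ c) (hf : IsEntireAlongLines S f)
    (hbound : HasExpBound N p c S f) : IsLipschitzOnBounded N S f := by
  refine fun B => ⟨Real.exp (q ^ (2 * p) * c * (B + B + 1) ^ p), (Real.exp_pos _).le,
    fun x hx y hy hxB hyB => (hf.norm_sub_le hN hp hc hbound hx hy).trans ?_⟩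
  have hx0 := hN.nonneg x
  have hy0 := hN.nonneg y
  have hq0 := hN.pos
  rw [mul_comm]
  gcongr
  exact hN.nonneg _

namespace IsLipschitzOnBounded

theorem exists_tendsto (hN : IsQuasiNorm N q) {S : Set V}
    (hS : @Dense V (quasiNormTopology N) S) {f : V → ℂ} (hf : IsLipschitzOnBounded N S f) (x : V) :
    ∃ l, Tendsto f (@nhdsWithin V (quasiNormTopology N) x S) (𝓝 l) := by
  let _ := quasiNormTopology N
  have : (𝓝[S] x).NeBot := mem_closure_iff_nhdsWithin_neBot.1 (hS x)
  have hq := hN.pos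
  refine cauchy_map_iff_exists_tendsto.1 (Metric.cauchy_iff.2 ⟨inferInstance, fun ε hε => ?_⟩)
  obtain ⟨C, hC, hf⟩ := hf (q * (1 + N x))
  have hN0 : Tendsto (fun y => N (y - x)) (𝓝[S] x) (𝓝 0) :=
    hN.tendsto_iff.1 (tendsto_id.mono_left nhdsWithin_le_nhds)
  have hδ : 0 < ε / (2 * q * (C + 1)) := by positivity
  refine ⟨_, image_mem_map (inter_mem self_mem_nhdsWithin (inter_mem
    (hN0.eventually_lt_const one_pos) (hN0.eventually_lt_const hδ))), ?_⟩
  rintro _ ⟨y, ⟨hyS, hy1, hyδ⟩, rfl⟩ _ ⟨z, ⟨hzS, hz1, hzδ⟩, rfl⟩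
  calc dist (f y) (f z) = ‖f y - f z‖ := dist_eq_norm _ _
    _ ≤ C * N (y - z) := hf y hyS z hzS (hN.le_of_sub_le_one (le_of_lt hy1))
        (hN.le_of_sub_le_one (le_of_lt hz1))
    _ ≤ C * (q * (N (y - x) + N (z - x))) := by
        gcongr
        exact hN.map_sub_rev z x ▸ hN.sub_le_sub y x z
    _ ≤ C * (q * (ε / (2 * q * (C + 1)) + ε / (2 * q * (C + 1)))) := by
        gcongr
        exacts [le_of_lt hyδ, le_of_lt hzδ]
    _ = ε * (C / (C + 1)) := by
        field_simp
        norm_num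
    _ < ε := mul_lt_of_lt_one_right hε ((div_lt_one (by positivity)).2 (lt_add_one C))

theorem exists_continuous_eqOn (hN : IsQuasiNorm N q) {S : Set V}
    (hS : @Dense V (quasiNormTopology N) S) {f : V → ℂ} (hf : IsLipschitzOnBounded N S f) :
    ∃ g : V → ℂ, Continuous[quasiNormTopology N, inferInstance] g ∧ Set.EqOn g f S := by
  let _ := quasiNormTopology N
  have hi : IsDenseInducing ((↑) : S → V) := ⟨.subtypeVal, hS.denseRange_val⟩
  have hlim : ∀ x : V, ∃ l, Tendsto (fun y : S => f y) (comap ((↑) : S → V) (𝓝 x)) (𝓝 l) := by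
    intro x
    obtain ⟨l, hl⟩ := hf.exists_tendsto hN hS x
    refine ⟨l, hl.comp (tendsto_nhdsWithin_iff.2 ⟨tendsto_comap, Eventually.of_forall ?_⟩)⟩
    exact Subtype.property
  refine ⟨hi.extend fun y : S => f y, hi.continuous_extend hlim, fun x hx => ?_⟩
  obtain ⟨l, hl⟩ := hlim x
  rw [← hi.nhds_eq_comap ⟨x, hx⟩] at hl
  exact hi.extend_eq_at (a := ⟨x, hx⟩) (continuousAt_of_tendsto_nhds hl)

theorem of_dense (hN : IsQuasiNorm N q) {S : Set V} (hS : @Dense V (quasiNormTopology N) S)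
    {g : V → ℂ} (hg : Continuous[quasiNormTopology N, inferInstance] g)
    (hgS : IsLipschitzOnBounded N S g) : IsLipschitzOnBounded N Set.univ g := by
  intro B
  have hq := hN.pos
  obtain ⟨C, hC, hgS⟩ := hgS (q * (1 + B))
  refine ⟨C * q ^ 2, by positivity, fun x _ y _ hx hy => ?_⟩
  obtain ⟨u, huS, hu⟩ := hN.exists_seq_of_dense hS x
  obtain ⟨v, hvS, hv⟩ := hN.exists_seq_of_dense hS y
  have hlim : Tendsto (fun n => ‖g (u n) - g (v n)‖) atTop (𝓝 ‖g x - g y‖) := by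
    let _ := quasiNormTopology N
    exact (((hg.tendsto x).comp (hN.tendsto_iff.2 hu)).sub
      ((hg.tendsto y).comp (hN.tendsto_iff.2 hv))).norm
  have hbound : Tendsto (fun n => C * (q * (N (u n - x) + q * (N (x - y) + N (v n - y))))) atTop
      (𝓝 (C * (q * (0 + q * (N (x - y) + 0))))) :=
    ((hu.add ((hv.const_add _).const_mul q)).const_mul q).const_mul C
  refine (le_of_tendsto_of_tendsto hlim hbound ?_).trans_eq (by ring)
  filter_upwards [hu.eventually_le_const one_pos, hv.eventually_le_const one_pos] with n hun hvn
  calc ‖g (u n) - g (v n)‖ ≤ C * N (u n - v n) :=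
        hgS _ (huS n) _ (hvS n) ((hN.le_of_sub_le_one hun).trans (by gcongr))
          ((hN.le_of_sub_le_one hvn).trans (by gcongr))
    _ ≤ C * (q * (N (u n - x) + q * (N (x - y) + N (v n - y)))) := by
        gcongr
        refine (hN.sub_le_sub (u n) x (v n)).trans ?_
        gcongr
        exact hN.map_sub_rev (v n) y ▸ hN.sub_le_sub x y (v n)

theorem tendstoLocallyUniformly_line (hN : IsQuasiNorm N q) {g : V → ℂ}
    (hg : IsLipschitzOnBounded N Set.univ g) {u v : ℕ → V} {x y : V}
    (hu : Tendsto (fun n => N (u n - x)) atTop (𝓝 0))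
    (hv : Tendsto (fun n => N (v n - y)) atTop (𝓝 0)) :
    TendstoLocallyUniformly (fun n (z : ℂ) => g (u n + z • v n)) (fun z => g (x + z • y))
      atTop := by
  rw [Metric.tendstoLocallyUniformly_iff]
  intro ε hε z₀
  have hq := hN.pos
  set r := ‖z₀‖ + 1
  have : 0 ≤ r := by positivity
  obtain ⟨C, hC, hg⟩ := hg (q * (q * (1 + N x) + r * (q * (1 + N y))))
  refine ⟨Metric.ball z₀ 1, Metric.ball_mem_nhds _ one_pos, ?_⟩
  have hlim : Tendsto (fun n => C * (q * (N (u n - x) + r * N (v n - y)))) atTop (𝓝 0) := by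
    simpa using ((hu.add (hv.const_mul r)).const_mul q).const_mul C
  filter_upwards [hlim.eventually_lt_const hε, hu.eventually_le_const one_pos,
    hv.eventually_le_const one_pos] with n hn hun hvn z hz
  have hzr : ‖z‖ ≤ r := by
    rw [mem_ball_iff_norm] at hz
    linarith [norm_le_norm_add_norm_sub' z z₀]
  have hself (w : V) : N (w - w) ≤ 1 := by
    rw [sub_self, hN.map_zero]
    exact zero_le_one
  calc dist (g (x + z • y)) (g (u n + z • v n)) = ‖g (u n + z • v n) - g (x + z • y)‖ := by
        rw [dist_comm, dist_eq_norm]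
    _ ≤ C * N (u n + z • v n - (x + z • y)) :=
        hg _ trivial _ trivial (hN.add_smul_le_of_sub_le_one hun hvn hzr)
          (hN.add_smul_le_of_sub_le_one (hself x) (hself y) hzr)
    _ = C * N (u n - x + z • (v n - y)) := by
        congr 2
        module
    _ ≤ C * (q * (N (u n - x) + r * N (v n - y))) := by
        gcongr
        refine (hN.add_smul_le _ _ z).trans ?_
        have := hN.nonneg (v n - y)
        gcongr
    _ < ε := hn

end IsLipschitzOnBounded

theorem IsEntireAlongLines.of_dense (hN : IsQuasiNorm N q) {S : Set V}
    (hS : @Dense V (quasiNormTopology N) S) {g : V → ℂ}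
    (hg : IsLipschitzOnBounded N Set.univ g) (hgS : IsEntireAlongLines S g) :
    IsEntireAlongLines Set.univ g := by
  intro x _ y _
  obtain ⟨u, huS, hu⟩ := hN.exists_seq_of_dense hS x
  obtain ⟨v, hvS, hv⟩ := hN.exists_seq_of_dense hS y
  rw [← differentiableOn_univ]
  exact (tendstoLocallyUniformlyOn_univ.2
    (hg.tendstoLocallyUniformly_line hN hu hv)).differentiableOn
    (Eventually.of_forall fun n => (hgS _ (huS n) _ (hvS n)).differentiableOn) isOpen_univ

end QuasiNorm

section FiniteRankPerturbation

open Module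

theorem norm_eval_mul_exp_le {P : Polynomial ℂ} {r : ℕ} (hP : P.natDegree ≤ r) {S : ℂ → ℂ}
    {T U : ℝ} {z : ℂ} (hz : 1 ≤ ‖z‖) (hS : ∀ t, ‖t‖ ≤ ‖z‖ → ‖S t - S 0‖ ≤ U)
    (hT : ∀ t, ‖t‖ = 1 → ‖P.eval t * Complex.exp (S t)‖ ≤ Real.exp T) :
    ‖P.eval z * Complex.exp (S z)‖ ≤ Real.exp (T + 2 * U) * ‖z‖ ^ r := by
  have hexp : ∀ {w : ℂ}, ‖w‖ ≤ U → ‖Complex.exp w‖ ≤ Real.exp U := fun hw =>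
    (Complex.norm_exp_le_exp_norm _).trans (Real.exp_le_exp.2 hw)
  have hcircle : ∀ t, ‖t‖ = 1 →
      ‖(P * Polynomial.C (Complex.exp (S 0))).eval t‖ ≤ Real.exp (T + U) := by
    intro t ht
    have hsplit : (P * Polynomial.C (Complex.exp (S 0))).eval t =
        P.eval t * Complex.exp (S t) * Complex.exp (-(S t - S 0)) := by
      simp [mul_assoc, ← Complex.exp_add]
    rw [hsplit, norm_mul, Real.exp_add]
    gcongr
    · exact hT t ht
    · exact hexp ((norm_neg _).trans_le (hS t (ht.trans_le hz)))
  have hsplit : P.eval z * Complex.exp (S z) =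
      (P * Polynomial.C (Complex.exp (S 0))).eval z * Complex.exp (S z - S 0) := by
    simp [mul_assoc, ← Complex.exp_add]
  calc ‖P.eval z * Complex.exp (S z)‖ ≤ Real.exp (T + U) * ‖z‖ ^ r * Real.exp U := by
        rw [hsplit, norm_mul]
        gcongr
        · exact norm_eval_le_mul_norm_pow ((Polynomial.natDegree_mul_C_le _ _).trans hP) hcircle hz
        · exact hexp (hS z le_rfl)
    _ = Real.exp (T + 2 * U) * ‖z‖ ^ r := by
        rw [two_mul, ← add_assoc, Real.exp_add (T + U)]
        ring

variable {X : Type u} [NormedAddCommGroup X] [NormedSpace ℂ X]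

theorem finrank_opRange_add_le {A B : X →L[ℂ] X} (hA : IsFiniteRank A) (hB : IsFiniteRank B) :
    finrank ℂ (opRange (A + B)) ≤ finrank ℂ (opRange A) + finrank ℂ (opRange B) := by
  have : FiniteDimensional ℂ (opRange A) := hA
  have : FiniteDimensional ℂ (opRange B) := hB
  exact (Submodule.finrank_mono (opRange_add_le A B)).trans
    (Submodule.finrank_add_le_finrank_add_finrank _ _)

theorem finrank_opRange_mul_le_left {A : X →L[ℂ] X} (hA : IsFiniteRank A) (B : X →L[ℂ] X) :
    finrank ℂ (opRange (A * B)) ≤ finrank ℂ (opRange A) :=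
  have : FiniteDimensional ℂ (opRange A) := hA
  Submodule.finrank_mono (opRange_mul_le A B)

theorem finrank_opRange_mul_le_right (A : X →L[ℂ] X) {B : X →L[ℂ] X} (hB : IsFiniteRank B) :
    finrank ℂ (opRange (A * B)) ≤ finrank ℂ (opRange B) := by
  have : FiniteDimensional ℂ (opRange B) := hB
  rw [opRange_mul_eq_map]
  exact Submodule.finrank_map_le _ _

theorem finrank_opRange_pow_sub_pow_le {A B : X →L[ℂ] X} (hA : IsFiniteRank A)
    (hB : IsFiniteRank B) {k : ℕ} (hk : k ≠ 0) :
    finrank ℂ (opRange (A ^ k - B ^ k)) ≤ k * finrank ℂ (opRange (A - B)) := by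
  induction k, Nat.one_le_iff_ne_zero.2 hk using Nat.le_induction with
  | base => rw [pow_one, pow_one, one_mul]
  | succ k hk1 ih =>
    have hk0 : k ≠ 0 := Nat.one_le_iff_ne_zero.1 hk1
    have hpow : IsFiniteRank (A ^ k - B ^ k) := (hA.pow hk0).sub (hB.pow hk0)
    have htelescope : A ^ (k + 1) - B ^ (k + 1) = A * (A ^ k - B ^ k) + (A - B) * B ^ k := by
      rw [pow_succ', pow_succ']
      noncomm_ring
    calc finrank ℂ (opRange (A ^ (k + 1) - B ^ (k + 1)))
        ≤ finrank ℂ (opRange (A * (A ^ k - B ^ k))) + finrank ℂ (opRange ((A - B) * B ^ k)) :=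
          htelescope ▸ finrank_opRange_add_le (hpow.mul_left A) ((hA.sub hB).mul_right _)
      _ ≤ k * finrank ℂ (opRange (A - B)) + finrank ℂ (opRange (A - B)) :=
          add_le_add ((finrank_opRange_mul_le_right A hpow).trans (ih hk0))
            (finrank_opRange_mul_le_left (hA.sub hB) _)
      _ = (k + 1) * finrank ℂ (opRange (A - B)) := by ring

theorem norm_finTrace_pow_sub_le {A B : X →L[ℂ] X} (hA : IsFiniteRank A) (hB : IsFiniteRank B)
    {r : ℕ} (hr : finrank ℂ (opRange (A - B)) ≤ r) {M : ℝ} (hAM : ‖A‖ ≤ M) (hBM : ‖B‖ ≤ M)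
    {k : ℕ} (hk : k ≠ 0) : ‖finTrace (A ^ k) - finTrace (B ^ k)‖ ≤ k * (2 * r * M ^ k) := by
  have hsub : IsFiniteRank (A ^ k - B ^ k) := (hA.pow hk).sub (hB.pow hk)
  have htrace : finTrace (A ^ k) - finTrace (B ^ k) = finTrace (A ^ k - B ^ k) := by
    rw [sub_eq_iff_eq_add, ← finTrace_add hsub (hB.pow hk), sub_add_cancel]
  have hrank : (finrank ℂ (opRange (A ^ k - B ^ k)) : ℝ) ≤ k * r := by
    exact_mod_cast (finrank_opRange_pow_sub_pow_le hA hB hk).trans (Nat.mul_le_mul_left k hr)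
  have hnorm : ‖A ^ k - B ^ k‖ ≤ 2 * M ^ k :=
    calc ‖A ^ k - B ^ k‖ ≤ ‖A ^ k‖ + ‖B ^ k‖ := _root_.norm_sub_le _ _
      _ ≤ ‖A‖ ^ k + ‖B‖ ^ k :=
        add_le_add (norm_pow_le' _ (Nat.pos_of_ne_zero hk)) (norm_pow_le' _ (Nat.pos_of_ne_zero hk))
      _ ≤ M ^ k + M ^ k := by gcongr
      _ = 2 * M ^ k := by ring
  calc ‖finTrace (A ^ k) - finTrace (B ^ k)‖
      ≤ finrank ℂ (opRange (A ^ k - B ^ k)) * ‖A ^ k - B ^ k‖ := htrace ▸ norm_finTrace_le hsub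
    _ ≤ k * r * (2 * M ^ k) := by gcongr
    _ = k * (2 * r * M ^ k) := by ring

/-- The exponent of the factor by which `det_p (I - F)` differs from `det (I - F)`. -/
noncomputable def regExponent (p : ℝ) (F : X →L[ℂ] X) : ℂ :=
  ∑ k ∈ Finset.Ico 1 ⌈p⌉₊, (1 / (k : ℂ)) * finTrace (F ^ k)

theorem norm_regExponent_sub_le (p : ℝ) {A B : X →L[ℂ] X} (hA : IsFiniteRank A)
    (hB : IsFiniteRank B) {r : ℕ} (hr : finrank ℂ (opRange (A - B)) ≤ r) {M : ℝ} (hAM : ‖A‖ ≤ M)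
    (hBM : ‖B‖ ≤ M) (hM : 1 ≤ M) :
    ‖regExponent p A - regExponent p B‖ ≤ ⌈p⌉₊ * (2 * r * M ^ (⌈p⌉₊ - 1)) := by
  have hterm : ∀ k ∈ Finset.Ico 1 ⌈p⌉₊,
      ‖1 / (k : ℂ) * finTrace (A ^ k) - 1 / (k : ℂ) * finTrace (B ^ k)‖ ≤
        2 * r * M ^ (⌈p⌉₊ - 1) := by
    intro k hk
    obtain ⟨hk1, hkp⟩ := Finset.mem_Ico.1 hk
    have : (0 : ℝ) < k := by exact_mod_cast hk1
    rw [← mul_sub, norm_mul, norm_div, norm_one, Complex.norm_natCast]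
    calc 1 / (k : ℝ) * ‖finTrace (A ^ k) - finTrace (B ^ k)‖
        ≤ 1 / (k : ℝ) * (k * (2 * r * M ^ k)) := by
          gcongr
          exact norm_finTrace_pow_sub_le hA hB hr hAM hBM (Nat.one_le_iff_ne_zero.1 hk1)
      _ = 2 * r * M ^ k := by field_simp
      _ ≤ 2 * r * M ^ (⌈p⌉₊ - 1) := by
          gcongr
          exact Nat.le_sub_one_of_lt hkp
  rw [regExponent, regExponent, ← Finset.sum_sub_distrib]
  calc _ ≤ ∑ k ∈ Finset.Ico 1 ⌈p⌉₊, 2 * r * M ^ (⌈p⌉₊ - 1) := norm_sum_le_of_le _ hterm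
    _ ≤ ⌈p⌉₊ * (2 * r * M ^ (⌈p⌉₊ - 1)) := by
        rw [Finset.sum_const, nsmul_eq_mul, Nat.card_Ico]
        gcongr
        exact Nat.sub_le _ _

-- In `t`, `det (I - (z E + t G))` is a polynomial of degree at most the rank of `G`, and the
-- exponent depends on `t` only to lower order in `z`; so the bound on `‖t‖ = 1` extends to `t = z`.
theorem norm_regDet_smul_add_smul_le {p : ℝ} {E G : X →L[ℂ] X} (hE : IsFiniteRank E)
    (hG : IsFiniteRank G) {b T : ℝ} (hb : ‖E‖ + ‖G‖ ≤ b) (hb1 : 1 ≤ b) {z : ℂ} (hz : 1 ≤ ‖z‖)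
    (hT : ∀ t : ℂ, ‖t‖ = 1 → ‖regDet p (z • E + t • G)‖ ≤ Real.exp T) :
    ‖regDet p (z • E + z • G)‖ ≤
      Real.exp (T + 2 * (⌈p⌉₊ * (2 * finrank ℂ (opRange G) * (‖z‖ * b) ^ (⌈p⌉₊ - 1)))) *
        ‖z‖ ^ finrank ℂ (opRange G) := by
  obtain ⟨P, hP, hPeval⟩ := exists_polynomial_detOneSub_add_smul (hE.smul z) hG
  have hreg : ∀ t, regDet p (z • E + t • G) =
      P.eval t * Complex.exp (regExponent p (z • E + t • G)) := fun t => hPeval t ▸ rfl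
  have hnorm : ∀ t : ℂ, ‖t‖ ≤ ‖z‖ → ‖z • E + t • G‖ ≤ ‖z‖ * b := fun t ht =>
    calc ‖z • E + t • G‖ ≤ ‖z‖ * ‖E‖ + ‖t‖ * ‖G‖ := by
          simpa only [norm_smul] using norm_add_le (z • E) (t • G)
      _ ≤ ‖z‖ * ‖E‖ + ‖z‖ * ‖G‖ := by gcongr
      _ = ‖z‖ * (‖E‖ + ‖G‖) := by ring
      _ ≤ ‖z‖ * b := by gcongr
  simp only [hreg] at hT ⊢
  refine norm_eval_mul_exp_le hP hz (fun t ht => ?_) hT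
  have hrank : finrank ℂ (opRange (z • E + t • G - (z • E + (0 : ℂ) • G))) ≤
      finrank ℂ (opRange G) := by
    have : FiniteDimensional ℂ (opRange G) := hG
    rw [zero_smul, add_zero, add_sub_cancel_left]
    exact Submodule.finrank_mono (opRange_smul_le t G)
  exact norm_regExponent_sub_le p ((hE.smul z).add (hG.smul t)) ((hE.smul z).add (hG.smul 0)) hrank
    (hnorm t ht) (hnorm 0 (by simp)) (one_le_mul_of_one_le_of_one_le hz hb1)

end FiniteRankPerturbation

section Extension

open Filter

variable {X : Type u} [NormedAddCommGroup X] [NormedSpace ℂ X]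
  {𝓘 : Submodule ℂ (X →L[ℂ] X)} {N : 𝓘 → ℝ} {p q γ Γ : ℝ}

/-- The finite rank operators in `𝓘`, as a subspace of `𝓘`. -/
def finiteRankSubmodule (𝓘 : Submodule ℂ (X →L[ℂ] X)) : Submodule ℂ 𝓘 where
  carrier := {F | IsFiniteRank (F : X →L[ℂ] X)}
  add_mem' hF hG := IsFiniteRank.add hF hG
  zero_mem' := by
    have hrange : opRange (0 : X →L[ℂ] X) = ⊥ := LinearMap.range_zero
    have hfin : FiniteDimensional ℂ (opRange (0 : X →L[ℂ] X)) := hrange ▸ inferInstance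
    exact hfin
  smul_mem' z _ hF := IsFiniteRank.smul hF z

/-- The filter of the finite rank operators that tend to `L` with respect to the quasi-norm `N`. -/
def finiteRankNhds (N : 𝓘 → ℝ) (L : 𝓘) : Filter 𝓘 :=
  @nhdsWithin 𝓘 (quasiNormTopology N) L (finiteRankSubmodule 𝓘)

theorem eventually_isFiniteRank (N : 𝓘 → ℝ) (L : 𝓘) :
    ∀ᶠ F : 𝓘 in finiteRankNhds N L, IsFiniteRank (F : X →L[ℂ] X) :=
  let _ := quasiNormTopology N
  self_mem_nhdsWithin

theorem tendsto_sub_finiteRankNhds (hN : IsQuasiNorm N q) (L : 𝓘) :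
    Tendsto (fun F => N (F - L)) (finiteRankNhds N L) (𝓝 0) :=
  let _ := quasiNormTopology N
  hN.tendsto_iff.1 (tendsto_id.mono_left nhdsWithin_le_nhds)

theorem isEntireAlongLines_regDet (p : ℝ) (𝓘 : Submodule ℂ (X →L[ℂ] X)) :
    IsEntireAlongLines (finiteRankSubmodule 𝓘) fun F : 𝓘 => regDet p (F : X →L[ℂ] X) :=
  fun _ hA _ hB => differentiable_regDet_add_smul p hA hB

namespace IsLpIdeal

theorem neBot_finiteRankNhds (h : IsLpIdeal p 𝓘 N q γ) (L : 𝓘) : (finiteRankNhds N L).NeBot :=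
  let _ := quasiNormTopology N
  mem_closure_iff_nhdsWithin_neBot.1 (h.finiteRank_dense L)

theorem tendsto_coe_finiteRankNhds (h : IsLpIdeal p 𝓘 N q γ) (L : 𝓘) :
    Tendsto (fun F : 𝓘 => (F : X →L[ℂ] X)) (finiteRankNhds N L) (𝓝 (L : X →L[ℂ] X)) :=
  tendsto_iff_norm_sub_tendsto_zero.2 (squeeze_zero (fun _ => norm_nonneg _)
    (fun F => h.opNorm_le (F - L)) (tendsto_sub_finiteRankNhds h.quasiNorm L))

theorem isCompactOperator [CompleteSpace X] (h : IsLpIdeal p 𝓘 N q γ) (L : 𝓘) :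
    IsCompactOperator (L : X →L[ℂ] X) :=
  have := h.neBot_finiteRankNhds L
  isCompactOperator_of_tendsto (h.tendsto_coe_finiteRankNhds L)
    ((eventually_isFiniteRank N L).mono fun _ hF => hF.isCompactOperator)

theorem eigenvalueSum_le (h : IsLpIdeal p 𝓘 N q γ) (hp : 0 < p) (L : 𝓘) :
    eigenvalueSum p (L : X →L[ℂ] X) ≤ ENNReal.ofReal (γ * N L) ^ p := by
  have hroot := ENNReal.rpow_le_rpow (h.eigenvalue_le L) hp.le
  rwa [← ENNReal.rpow_mul, one_div_mul_cancel hp.ne', ENNReal.rpow_one] at hroot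

theorem eigenvalueSum_ne_top (h : IsLpIdeal p 𝓘 N q γ) (hp : 0 < p) (L : 𝓘) :
    eigenvalueSum p (L : X →L[ℂ] X) ≠ ∞ :=
  ne_top_of_le_ne_top (ENNReal.rpow_ne_top_of_nonneg hp.le ENNReal.ofReal_ne_top)
    (h.eigenvalueSum_le hp L)

theorem toReal_eigenvalueSum_le (h : IsLpIdeal p 𝓘 N q γ) (hp : 0 < p) (L : 𝓘) :
    (eigenvalueSum p (L : X →L[ℂ] X)).toReal ≤ |γ| ^ p * N L ^ p := by
  have hL := h.quasiNorm.nonneg L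
  refine ENNReal.toReal_le_of_le_ofReal (by positivity) ?_
  rw [← Real.mul_rpow (abs_nonneg γ) hL, ← ENNReal.ofReal_rpow_of_nonneg (by positivity) hp.le]
  refine (h.eigenvalueSum_le hp L).trans ?_
  gcongr
  exact le_abs_self γ

theorem hasExpBound_of_le_exp_eigenvalueSum (h : IsLpIdeal p 𝓘 N q γ) (hp : 0 < p) (hΓ : 0 ≤ Γ)
    {S : Set 𝓘} {f : 𝓘 → ℂ} (hf : ∀ L ∈ S, ‖f L‖ ≤
      Real.exp (Γ * (eigenvalueSum p (L : X →L[ℂ] X)).toReal)) :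
    HasExpBound N p (|γ| ^ p * Γ) S f := by
  refine fun L hL => (hf L hL).trans (Real.exp_le_exp.2 ?_)
  rw [mul_comm (|γ| ^ p), mul_assoc]
  exact mul_le_mul_of_nonneg_left (h.toReal_eigenvalueSum_le hp L) hΓ

theorem hasExpBound_regDet (h : IsLpIdeal p 𝓘 N q γ) (hp : 0 < p) (hΓ : IsGrowthConstant X p Γ) :
    HasExpBound N p (|γ| ^ p * Γ) (finiteRankSubmodule 𝓘) fun F => regDet p (F : X →L[ℂ] X) :=
  h.hasExpBound_of_le_exp_eigenvalueSum hp hΓ.1.le fun F hF => hΓ.2 F hF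

theorem isLipschitzOnBounded_regDet (h : IsLpIdeal p 𝓘 N q γ) (hp : 0 < p)
    (hΓ : IsGrowthConstant X p Γ) :
    IsLipschitzOnBounded N (finiteRankSubmodule 𝓘) fun F => regDet p (F : X →L[ℂ] X) :=
  have hΓ0 := hΓ.1
  (isEntireAlongLines_regDet p 𝓘).isLipschitzOnBounded h.quasiNorm hp (by positivity)
    (h.hasExpBound_regDet hp hΓ)

theorem existsUnique_isContinuousDetExtension (h : IsLpIdeal p 𝓘 N q γ) (hp : 0 < p)
    (hΓ : IsGrowthConstant X p Γ) : ∃! D : 𝓘 → ℂ, IsContinuousDetExtension p 𝓘 N D := by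
  let _ := quasiNormTopology N
  obtain ⟨D, hD, hreg⟩ :=
    (h.isLipschitzOnBounded_regDet hp hΓ).exists_continuous_eqOn h.quasiNorm h.finiteRank_dense
  exact ⟨D, ⟨hD, hreg⟩, fun D' hD' => hD'.1.ext_on h.finiteRank_dense hD fun F hF =>
    (hD'.2 F hF).trans (hreg hF).symm⟩

end IsLpIdeal

namespace IsContinuousDetExtension

variable {D : 𝓘 → ℂ}

theorem tendsto_regDet (hD : IsContinuousDetExtension p 𝓘 N D) (L : 𝓘) :
    Tendsto (fun F : 𝓘 => regDet p (F : X →L[ℂ] X)) (finiteRankNhds N L) (𝓝 (D L)) := by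
  let _ := quasiNormTopology N
  exact ((hD.1.tendsto L).mono_left nhdsWithin_le_nhds).congr'
    ((eventually_isFiniteRank N L).mono hD.2)

theorem isEntireAlongLines (hD : IsContinuousDetExtension p 𝓘 N D) (h : IsLpIdeal p 𝓘 N q γ)
    (hp : 0 < p) (hΓ : IsGrowthConstant X p Γ) : IsEntireAlongLines Set.univ D := by
  have hEq : Set.EqOn D (fun F : 𝓘 => regDet p (F : X →L[ℂ] X)) (finiteRankSubmodule 𝓘) := hD.2
  have hLip : IsLipschitzOnBounded N (finiteRankSubmodule 𝓘) D :=
    (h.isLipschitzOnBounded_regDet hp hΓ).congr hEq.symm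
  exact .of_dense h.quasiNorm h.finiteRank_dense
    (.of_dense h.quasiNorm h.finiteRank_dense hD.1 hLip)
    ((isEntireAlongLines_regDet p 𝓘).congr hEq.symm)

end IsContinuousDetExtension

end Extension

section Growth

open Filter Asymptotics

theorem eventually_exp_mul_pow_le {m : ℕ} (hm : 0 < m) {a b : ℝ} (hab : a < b) (C : ℝ) (r : ℕ) :
    ∀ᶠ x : ℝ in atTop, Real.exp (a * x ^ m + C * x ^ (m - 1)) * x ^ r ≤ Real.exp (b * x ^ m) := by
  have hlog : Real.log =o[atTop] fun x : ℝ => x ^ m := by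
    simpa only [Real.rpow_natCast] using isLittleO_log_rpow_atTop (Nat.cast_pos.2 hm)
  have hlower : (fun x : ℝ => C * x ^ (m - 1) + r * Real.log x) =o[atTop] fun x => x ^ m :=
    ((isLittleO_pow_pow_atTop_of_lt (Nat.sub_lt hm one_pos)).const_mul_left C).add
      (hlog.const_mul_left r)
  filter_upwards [hlower.bound (sub_pos.2 hab), eventually_gt_atTop 0] with x hx hx0
  rw [Real.norm_of_nonneg (pow_nonneg hx0.le m)] at hx
  rw [← Real.exp_log (pow_pos hx0 r), Real.log_pow, ← Real.exp_add, Real.exp_le_exp]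
  linarith [Real.le_norm_self (C * x ^ (m - 1) + r * Real.log x)]

theorem exists_pos_mul_rpow_le {p : ℝ} (hp : 0 < p) (c a : ℝ) {η : ℝ} (hη : 0 < η) :
    ∃ δ > 0, c * (a * δ) ^ p ≤ η := by
  have hcont : Continuous fun δ : ℝ => c * (a * δ) ^ p :=
    continuous_const.mul ((continuous_const.mul continuous_id).rpow_const fun _ => .inr hp.le)
  have hlim : Tendsto (fun δ : ℝ => c * (a * δ) ^ p) (𝓝[>] 0) (𝓝 0) := by
    simpa [Real.zero_rpow hp.ne'] using (hcont.tendsto 0).mono_left nhdsWithin_le_nhds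
  exact ((eventually_mem_nhdsWithin (s := Set.Ioi (0 : ℝ))).and
    (hlim.eventually_le_const hη)).exists

theorem IsQuasiNorm.smul_add_smul_le {V : Type*} [AddCommGroup V] [Module ℂ V] {N : V → ℝ} {q : ℝ}
    (hN : IsQuasiNorm N q) {x y : V} {δ : ℝ} {z t : ℂ} (hx : N x ≤ δ) (hy : N y ≤ ‖z‖ * δ)
    (ht : ‖t‖ ≤ 1) : N (z • x + t • y) ≤ 2 * q * δ * ‖z‖ := by
  have hq := hN.pos
  calc N (z • x + t • y) ≤ q * (‖z‖ * N x + ‖t‖ * N y) := by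
        simpa only [hN.smul_eq] using hN.add_le (z • x) (t • y)
    _ ≤ q * (‖z‖ * δ + 1 * (‖z‖ * δ)) := by
        gcongr
        exact hN.nonneg y
    _ = 2 * q * δ * ‖z‖ := by ring

variable {X : Type u} [NormedAddCommGroup X] [NormedSpace ℂ X]
  {𝓘 : Submodule ℂ (X →L[ℂ] X)} {N : 𝓘 → ℝ} {p q γ Γ : ℝ}

theorem norm_regDet_smul_add_smul_le_exp (hN : IsQuasiNorm N q) (hp : 0 < p) {c : ℝ} (hc : 0 ≤ c)
    (hbound : HasExpBound N p c (finiteRankSubmodule 𝓘) fun F => regDet p (F : X →L[ℂ] X))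
    {E G : 𝓘} (hE : IsFiniteRank (E : X →L[ℂ] X)) (hG : IsFiniteRank (G : X →L[ℂ] X)) {δ : ℝ}
    (hδ : 0 ≤ δ) {z t : ℂ} (hEδ : N E ≤ δ) (hGδ : N G ≤ ‖z‖ * δ) (ht : ‖t‖ ≤ 1) :
    ‖regDet p (z • (E : X →L[ℂ] X) + t • (G : X →L[ℂ] X))‖ ≤
      Real.exp (c * (2 * q * δ) ^ p * ‖z‖ ^ p) := by
  have hq := hN.pos
  refine (hbound (z • E + t • G) ((hE.smul z).add (hG.smul t))).trans (Real.exp_le_exp.2 ?_)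
  rw [mul_assoc, ← Real.mul_rpow (by positivity) (norm_nonneg z)]
  gcongr
  · exact hN.nonneg _
  · exact hN.smul_add_smul_le hEδ hGδ ht

theorem IsLpIdeal.norm_regDet_smul_add_le (h : IsLpIdeal p 𝓘 N q γ) (hp : 0 < p)
    (hΓ : IsGrowthConstant X p Γ) {E G : 𝓘} (hE : IsFiniteRank (E : X →L[ℂ] X))
    (hG : IsFiniteRank (G : X →L[ℂ] X)) {δ : ℝ} (hδ : 0 ≤ δ) {z : ℂ} (hz : 1 ≤ ‖z‖)
    (hEδ : N E ≤ δ) (hGδ : N G ≤ ‖z‖ * δ) :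
    ‖regDet p (z • ((E + G : 𝓘) : X →L[ℂ] X))‖ ≤
      Real.exp (|γ| ^ p * Γ * (2 * q * δ) ^ p * ‖z‖ ^ p +
        2 * (⌈p⌉₊ * (2 * Module.finrank ℂ (opRange (G : X →L[ℂ] X)) *
          max 1 (δ + N G) ^ (⌈p⌉₊ - 1))) * ‖z‖ ^ (⌈p⌉₊ - 1)) *
        ‖z‖ ^ Module.finrank ℂ (opRange (G : X →L[ℂ] X)) := by
  have hΓ0 := hΓ.1
  have hnorm : ‖(E : X →L[ℂ] X)‖ + ‖(G : X →L[ℂ] X)‖ ≤ max 1 (δ + N G) :=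
    (add_le_add ((h.opNorm_le E).trans hEδ) (h.opNorm_le G)).trans (le_max_right _ _)
  have hcircle : ∀ t : ℂ, ‖t‖ = 1 → ‖regDet p (z • (E : X →L[ℂ] X) + t • (G : X →L[ℂ] X))‖ ≤
      Real.exp (|γ| ^ p * Γ * (2 * q * δ) ^ p * ‖z‖ ^ p) := fun t ht =>
    norm_regDet_smul_add_smul_le_exp h.quasiNorm hp (by positivity) (h.hasExpBound_regDet hp hΓ)
      hE hG hδ hEδ hGδ ht.le
  rw [Submodule.coe_add, smul_add]
  refine (norm_regDet_smul_add_smul_le hE hG hnorm (le_max_left _ _) hz hcircle).trans_eq ?_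
  rw [mul_pow]
  ring_nf

-- Write `F = (F - G) + G` with `G` a fixed finite rank operator close to `L`: the first summand
-- contributes a small type, the second one only lower order growth.
theorem IsLpIdeal.exists_eventually_norm_regDet_smul_le (h : IsLpIdeal p 𝓘 N q γ) (hp : 0 < p)
    (hΓ : IsGrowthConstant X p Γ) (hpm : (⌈p⌉₊ : ℝ) = p) (L : 𝓘) {η : ℝ} (hη : 0 < η) :
    ∃ R ≥ 1, ∀ᶠ F : 𝓘 in finiteRankNhds N L, IsFiniteRank (F : X →L[ℂ] X) ∧
      ∀ z : ℂ, R ≤ ‖z‖ → ‖regDet p (z • (F : X →L[ℂ] X))‖ ≤ Real.exp (η * ‖z‖ ^ ⌈p⌉₊) := by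
  have hN := h.quasiNorm
  have hq := hN.pos
  have := h.neBot_finiteRankNhds L
  obtain ⟨δ, hδ, hδη⟩ := exists_pos_mul_rpow_le hp (|γ| ^ p * Γ) (2 * q) (half_pos hη)
  have hnear : ∀ᶠ F : 𝓘 in finiteRankNhds N L,
      IsFiniteRank (F : X →L[ℂ] X) ∧ N (F - L) ≤ δ / (2 * q) :=
    (eventually_isFiniteRank N L).and
      ((tendsto_sub_finiteRankNhds hN L).eventually_le_const (by positivity))
  obtain ⟨G, hG, hGL⟩ := hnear.exists
  obtain ⟨R, hR⟩ := eventually_atTop.1 ((eventually_exp_mul_pow_le (Nat.ceil_pos.2 hp)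
    (half_lt_self hη) (2 * (⌈p⌉₊ * (2 * Module.finrank ℂ (opRange (G : X →L[ℂ] X)) *
      max 1 (δ + N G) ^ (⌈p⌉₊ - 1)))) (Module.finrank ℂ (opRange (G : X →L[ℂ] X)))).and
    (eventually_ge_atTop (N G / δ)))
  refine ⟨max R 1, le_max_right _ _, hnear.mono fun F ⟨hF, hFL⟩ => ⟨hF, fun z hz => ?_⟩⟩
  obtain ⟨hgrowth, hzδ⟩ := hR ‖z‖ ((le_max_left _ _).trans hz)
  have hE : N (F - G) ≤ δ :=
    calc N (F - G) ≤ q * (N (F - L) + N (G - L)) := hN.map_sub_rev G L ▸ hN.sub_le_sub F L G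
      _ ≤ q * (δ / (2 * q) + δ / (2 * q)) := by gcongr
      _ = δ := by
          field_simp
          norm_num
  have hF' := h.norm_regDet_smul_add_le hp hΓ (hF.sub hG) hG hδ.le ((le_max_right _ _).trans hz)
    hE ((div_le_iff₀ hδ).1 hzδ)
  rw [sub_add_cancel] at hF'
  refine hF'.trans (le_trans ?_ hgrowth)
  rw [← Real.rpow_natCast ‖z‖ ⌈p⌉₊, hpm]
  gcongr

end Growth

section Scaling

open Module

variable {X : Type u} [NormedAddCommGroup X] [NormedSpace ℂ X]

theorem genEigenspaceOf_smul {z : ℂ} (hz : z ≠ 0) (F : X →L[ℂ] X) (μ : ℂ) :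
    genEigenspaceOf (z • F) (z * μ) = genEigenspaceOf F μ := by
  ext x
  have h : (((z • F : X →L[ℂ] X) : X →ₗ[ℂ] X) - (z * μ) • (1 : End ℂ X)) =
      z • ((F : X →ₗ[ℂ] X) - μ • (1 : End ℂ X)) := by
    ext y
    simp [smul_sub, mul_smul]
  rw [genEigenspaceOf, genEigenspaceOf, End.mem_maxGenEigenspace, End.mem_maxGenEigenspace, h]
  refine exists_congr fun k => ?_
  rw [smul_pow, LinearMap.smul_apply, smul_eq_zero_iff_right (pow_ne_zero _ hz)]

theorem nonzeroEigenvalues_smul {z : ℂ} (hz : z ≠ 0) {F : X →L[ℂ] X} (hF : IsFiniteRank F) :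
    nonzeroEigenvalues (z • F) = (nonzeroEigenvalues F).map (z * ·) := by
  ext μ
  obtain ⟨ν, rfl⟩ : ∃ ν, μ = z * ν := ⟨z⁻¹ * μ, by field_simp⟩
  rw [Multiset.count_map_eq_count' _ _ (mul_right_injective₀ hz)]
  rcases eq_or_ne ν 0 with rfl | hν
  · rw [mul_zero, Multiset.count_eq_zero_of_notMem fun h => ne_zero_of_mem_nonzeroEigenvalues h rfl,
      Multiset.count_eq_zero_of_notMem fun h => ne_zero_of_mem_nonzeroEigenvalues h rfl]
  · rw [count_nonzeroEigenvalues (hF.smul z) (mul_ne_zero hz hν), count_nonzeroEigenvalues hF hν,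
      genEigenspaceOf_smul hz]

theorem prod_regDet_nthRoots_smul {p : ℝ} (hp : 0 < p) {z : ℂ} (hz : z ≠ 0) {F : X →L[ℂ] X}
    (hF : IsFiniteRank F) :
    ∏ ω ∈ Polynomial.nthRootsFinset ⌈p⌉₊ (1 : ℂ), regDet p ((ω * z) • F) =
      ((nonzeroEigenvalues F).map fun μ => 1 - z ^ ⌈p⌉₊ * μ ^ ⌈p⌉₊).prod := by
  have hm : 0 < ⌈p⌉₊ := Nat.ceil_pos.2 hp
  have h : ∀ ω ∈ Polynomial.nthRootsFinset ⌈p⌉₊ (1 : ℂ), regDet p ((ω * z) • F) =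
      ((nonzeroEigenvalues F).map fun μ => weierstrassFactor ⌈p⌉₊ (ω * (z * μ))).prod := by
    intro ω hω
    rw [Polynomial.mem_nthRootsFinset hm] at hω
    have hω0 : ω ≠ 0 := by
      rintro rfl
      rw [zero_pow hm.ne'] at hω
      exact zero_ne_one hω
    rw [regDet_eq_prod p (hF.smul _), nonzeroEigenvalues_smul (mul_ne_zero hω0 hz) hF,
      Multiset.map_map]
    simp only [Function.comp_def, mul_assoc]
  rw [Finset.prod_congr rfl h, ← Multiset.prod_map_prod]
  simp_rw [prod_weierstrassFactor_nthRootsFinset hm, mul_pow]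

theorem norm_prod_one_sub_mul_pow_le {p : ℝ} (hp : 0 < p) {F : X →L[ℂ] X} (hF : IsFiniteRank F)
    {η R₀ : ℝ} (hR₀ : 0 < R₀)
    (hgrowth : ∀ z : ℂ, R₀ ≤ ‖z‖ → ‖regDet p (z • F)‖ ≤ Real.exp (η * ‖z‖ ^ ⌈p⌉₊)) {w : ℂ}
    (hw : R₀ ^ ⌈p⌉₊ ≤ ‖w‖) :
    ‖((nonzeroEigenvalues F).map fun μ => 1 - w * μ ^ ⌈p⌉₊).prod‖ ≤
      Real.exp (⌈p⌉₊ * (η * ‖w‖)) := by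
  have hm : 0 < ⌈p⌉₊ := Nat.ceil_pos.2 hp
  obtain ⟨z, rfl⟩ := IsAlgClosed.exists_pow_nat_eq w hm
  rw [norm_pow] at hw
  have hz : R₀ ≤ ‖z‖ := le_of_pow_le_pow_left₀ hm.ne' (norm_nonneg z) hw
  rw [← prod_regDet_nthRoots_smul hp (norm_pos_iff.1 (hR₀.trans_le hz)) hF, norm_prod]
  calc ∏ ω ∈ Polynomial.nthRootsFinset ⌈p⌉₊ (1 : ℂ), ‖regDet p ((ω * z) • F)‖
      ≤ ∏ _ω ∈ Polynomial.nthRootsFinset ⌈p⌉₊ (1 : ℂ), Real.exp (η * ‖z ^ ⌈p⌉₊‖) := by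
        refine Finset.prod_le_prod (fun _ _ => norm_nonneg _) fun ω hω => ?_
        have hnorm : ‖ω * z‖ = ‖z‖ := by
          rw [norm_mul, Complex.norm_eq_one_of_pow_eq_one
            ((Polynomial.mem_nthRootsFinset hm _).1 hω) hm.ne', one_mul]
        simpa only [hnorm, norm_pow] using hgrowth (ω * z) (hz.trans_eq hnorm.symm)
    _ = Real.exp (⌈p⌉₊ * (η * ‖z ^ ⌈p⌉₊‖)) := by
        rw [Finset.prod_const, (Complex.isPrimitiveRoot_exp _ hm.ne').card_nthRootsFinset,
          Real.exp_nat_mul]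

end Scaling

section SmallEigenvalues

open Filter

theorem one_le_norm_prod_one_sub_mul_pow {m : ℕ} {w : ℂ} {ρ : ℝ} (hρ : 0 ≤ ρ)
    (hw : 2 ≤ ‖w‖ * ρ ^ m) (s : Multiset ℂ) (hs : ∀ μ ∈ s, ρ ≤ ‖μ‖) :
    1 ≤ ‖(s.map fun μ => 1 - w * μ ^ m).prod‖ := by
  refine Multiset.prod_induction (fun u : ℂ => 1 ≤ ‖u‖) _
    (fun u v hu hv => (norm_mul u v).symm ▸ one_le_mul_of_one_le_of_one_le hu hv) (by simp) ?_
  intro u hu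
  obtain ⟨μ, hμ, rfl⟩ := Multiset.mem_map.1 hu
  have hμρ := hs μ hμ
  have htwo : 2 ≤ ‖w * μ ^ m‖ := by
    rw [norm_mul, norm_pow]
    exact hw.trans (by gcongr)
  have htri := norm_sub_norm_le (w * μ ^ m) 1
  rw [norm_one, norm_sub_rev] at htri
  linarith

theorem norm_sum_map_pow_le {m : ℕ} {ρ R M : ℝ} (hR : 0 < R) (hM : 0 < M) (hρR : R * ρ ^ m ≤ 2)
    (s : Multiset ℂ) (hs : ∀ μ ∈ s, ‖μ‖ ≤ ρ)
    (hprod : ∀ w : ℂ, ‖w‖ = R → ‖(s.map fun μ => 1 - w * μ ^ m).prod‖ ≤ Real.exp M) :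
    ‖(s.map (· ^ m)).sum‖ ≤ 8 * M / R := by
  obtain ⟨k, hk⟩ : ∃ k, s.card = k := ⟨_, rfl⟩
  obtain ⟨f, rfl⟩ := exists_map_univ_fin_eq s hk
  simp only [Multiset.map_map] at hprod ⊢
  refine norm_sum_le_of_norm_prod_le hR hM (fun i => ?_) hprod
  have hi : ‖f i‖ ≤ ρ := hs _ (Multiset.mem_map_of_mem f (Finset.mem_univ i))
  rw [Function.comp_apply, norm_pow, mul_comm]
  exact le_trans (by gcongr) hρR

-- The eigenvalues of modulus at least `ρ` only increase `∏ (1 - w * μ ^ m)` on the circle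
-- `‖w‖ = 2 / ρ ^ m`, so they may be left out of the product.
theorem norm_sum_small_pow_le {m : ℕ} {ρ η : ℝ} (hρ : 0 < ρ) (hη : 0 < η) (s : Multiset ℂ)
    (hprod : ∀ w : ℂ, ‖w‖ = 2 / ρ ^ m →
      ‖(s.map fun μ => 1 - w * μ ^ m).prod‖ ≤ Real.exp (η / 8 * (2 / ρ ^ m))) :
    ‖((s.filter fun μ => ¬ ρ ≤ ‖μ‖).map (· ^ m)).sum‖ ≤ η := by
  have hR : 0 < 2 / ρ ^ m := by positivity
  have hRρ : 2 / ρ ^ m * ρ ^ m = 2 := div_mul_cancel₀ 2 (by positivity)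
  refine (norm_sum_map_pow_le hR (M := η / 8 * (2 / ρ ^ m)) (by positivity) hRρ.le _
    (fun μ hμ => (not_le.1 (Multiset.mem_filter.1 hμ).2).le) fun w hw => ?_).trans_eq
    (by field_simp)
  refine le_trans ?_ (hprod w hw)
  conv_rhs => rw [← Multiset.filter_add_not (fun μ : ℂ => ρ ≤ ‖μ‖) s]
  rw [Multiset.map_add, Multiset.prod_add, norm_mul]
  exact le_mul_of_one_le_left (norm_nonneg _) (one_le_norm_prod_one_sub_mul_pow hρ.le
    (hw ▸ hRρ.ge) _ fun μ hμ => (Multiset.mem_filter.1 hμ).2)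

theorem IsLpIdeal.exists_eventually_norm_sum_small_pow_le {X : Type u} [NormedAddCommGroup X]
    [NormedSpace ℂ X] {𝓘 : Submodule ℂ (X →L[ℂ] X)} {N : 𝓘 → ℝ} {p q γ Γ : ℝ}
    (h : IsLpIdeal p 𝓘 N q γ) (hp : 0 < p) (hΓ : IsGrowthConstant X p Γ) (hpm : (⌈p⌉₊ : ℝ) = p)
    (L : 𝓘) {η ρ₁ : ℝ} (hη : 0 < η) (hρ₁ : 0 < ρ₁) :
    ∃ ρ > 0, ρ ≤ ρ₁ ∧ ∀ᶠ F : 𝓘 in finiteRankNhds N L,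
      ‖(((nonzeroEigenvalues (F : X →L[ℂ] X)).filter fun μ => ¬ ρ ≤ ‖μ‖).map
        (· ^ ⌈p⌉₊)).sum‖ ≤ η := by
  have : (0 : ℝ) < ⌈p⌉₊ := Nat.cast_pos.2 (Nat.ceil_pos.2 hp)
  obtain ⟨R₀, hR₀, hgrowth⟩ := h.exists_eventually_norm_regDet_smul_le hp hΓ hpm L
    (η := η / (8 * ⌈p⌉₊)) (by positivity)
  have hR₀0 : 0 < R₀ := one_pos.trans_le hR₀
  have hρ : 0 < min ρ₁ R₀⁻¹ := lt_min hρ₁ (inv_pos.2 hR₀0)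
  have hρR₀ : R₀ ^ ⌈p⌉₊ ≤ 2 / min ρ₁ R₀⁻¹ ^ ⌈p⌉₊ := by
    calc R₀ ^ ⌈p⌉₊ ≤ (min ρ₁ R₀⁻¹)⁻¹ ^ ⌈p⌉₊ := by
          gcongr
          exact le_inv_of_le_inv₀ hρ (min_le_right _ _)
      _ = 1 / min ρ₁ R₀⁻¹ ^ ⌈p⌉₊ := by rw [inv_pow, one_div]
      _ ≤ 2 / min ρ₁ R₀⁻¹ ^ ⌈p⌉₊ := by
          gcongr
          exact one_le_two
  refine ⟨min ρ₁ R₀⁻¹, hρ, min_le_left _ _, hgrowth.mono fun F ⟨hF, hFR⟩ =>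
    norm_sum_small_pow_le hρ hη _ fun w hw => ?_⟩
  refine (norm_prod_one_sub_mul_pow_le hp hF hR₀0 hFR (hρR₀.trans_eq hw.symm)).trans_eq ?_
  rw [hw]
  field_simp

end SmallEigenvalues

section Tail

open Filter

theorem sum_map_norm_rpow_le_of_le (p : ℝ) {s t : Multiset ℂ} (h : s ≤ t) :
    (s.map (‖·‖ ^ p)).sum ≤ (t.map (‖·‖ ^ p)).sum := by
  obtain ⟨u, rfl⟩ := Multiset.le_iff_exists_add.1 h
  rw [Multiset.map_add, Multiset.sum_add]
  exact le_add_of_nonneg_right (sum_map_norm_rpow_nonneg p u)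

theorem norm_weierstrassFactor_le_of_norm_le_rpow {p a : ℝ} {m : ℕ} (hm : 1 ≤ m) (hp : 0 ≤ p)
    (hpm : p < m) (ha : 0 ≤ a) {u : ℂ} (hu : ‖u‖ ≤ 1 / 2) (hua : ‖u‖ ≤ a ^ ((m : ℝ) - p)⁻¹) :
    ‖weierstrassFactor m u‖ ≤ Real.exp (2 * a * ‖u‖ ^ p) := by
  have hmp : 0 < (m : ℝ) - p := sub_pos.2 hpm
  have hua' : ‖u‖ ^ ((m : ℝ) - p) ≤ a :=
    calc ‖u‖ ^ ((m : ℝ) - p) ≤ (a ^ ((m : ℝ) - p)⁻¹) ^ ((m : ℝ) - p) := by gcongr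
      _ = a := Real.rpow_inv_rpow ha hmp.ne'
  have hpow : ‖u‖ ^ m = ‖u‖ ^ ((m : ℝ) - p) * ‖u‖ ^ p := by
    rw [← Real.rpow_add_of_nonneg (norm_nonneg _) hmp.le hp, sub_add_cancel, Real.rpow_natCast]
  refine (norm_weierstrassFactor_le_of_norm_le_half hm hu).trans (Real.exp_le_exp.2 ?_)
  rw [hpow, mul_assoc]
  gcongr

theorem exists_forall_norm_prod_weierstrassFactor_le {p : ℝ} (hp : 0 < p) {m : ℕ} (hpm : p < m)
    (C : ℝ) {ε : ℝ} (hε : 0 < ε) :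
    ∃ ρ > 0, ∀ s : Multiset ℂ, (∀ μ ∈ s, ‖μ‖ ≤ ρ) → (s.map (‖·‖ ^ p)).sum ≤ C →
      ‖(s.map (weierstrassFactor m)).prod‖ ≤ Real.exp ε := by
  have hm : 1 ≤ m := by exact_mod_cast hp.trans hpm
  have ha : 0 < ε / (2 * (|C| + 1)) := by positivity
  refine ⟨min (1 / 2) ((ε / (2 * (|C| + 1))) ^ ((m : ℝ) - p)⁻¹), by positivity,
    fun s hs hsum => ?_⟩
  refine (norm_prod_map_le_exp s fun μ hμ => norm_weierstrassFactor_le_of_norm_le_rpow hm hp.le hpm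
    ha.le (le_min_iff.1 (hs μ hμ)).1 (le_min_iff.1 (hs μ hμ)).2).trans (Real.exp_le_exp.2 ?_)
  rw [Multiset.sum_map_mul_left]
  calc 2 * (ε / (2 * (|C| + 1))) * (s.map (‖·‖ ^ p)).sum
      ≤ 2 * (ε / (2 * (|C| + 1))) * (|C| + 1) := by
        gcongr
        linarith [le_abs_self C]
    _ = ε := by field_simp

theorem prod_map_weierstrassFactor_succ {m : ℕ} (hm : 1 ≤ m) (s : Multiset ℂ) :
    (s.map (weierstrassFactor (m + 1))).prod =
      (s.map (weierstrassFactor m)).prod * Complex.exp (1 / (m : ℂ) * (s.map (· ^ m)).sum) := by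
  rw [← Multiset.sum_map_mul_left, Complex.exp_multiset_sum, Multiset.map_map,
    ← Multiset.prod_map_mul]
  exact congrArg _ (Multiset.map_congr rfl fun u _ => weierstrassFactor_succ hm u)

theorem norm_prod_map_weierstrassFactor_le {m : ℕ} (hm : 1 ≤ m) (s : Multiset ℂ) :
    ‖(s.map (weierstrassFactor m)).prod‖ ≤
      ‖(s.map (weierstrassFactor (m + 1))).prod‖ * Real.exp ‖(s.map (· ^ m)).sum‖ := by
  have hm' : (1 : ℝ) ≤ m := by exact_mod_cast hm
  have hcoeff : ‖-(1 / (m : ℂ) * (s.map (· ^ m)).sum)‖ ≤ ‖(s.map (· ^ m)).sum‖ := by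
    rw [norm_neg, norm_mul, norm_div, norm_one, Complex.norm_natCast]
    exact mul_le_of_le_one_left (norm_nonneg _) (div_le_one_of_le₀ hm' (by positivity))
  calc ‖(s.map (weierstrassFactor m)).prod‖
      = ‖(s.map (weierstrassFactor (m + 1))).prod‖ *
          ‖Complex.exp (-(1 / (m : ℂ) * (s.map (· ^ m)).sum))‖ := by
        rw [← norm_mul, prod_map_weierstrassFactor_succ hm, mul_assoc, ← Complex.exp_add,
          add_neg_cancel, Complex.exp_zero, mul_one]
    _ ≤ _ := by
        gcongr
        exact (Complex.norm_exp_le_exp_norm _).trans (Real.exp_le_exp.2 hcoeff)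

variable {X : Type u} [NormedAddCommGroup X] [NormedSpace ℂ X] [CompleteSpace X]
  {𝓘 : Submodule ℂ (X →L[ℂ] X)} {N : 𝓘 → ℝ} {p q γ Γ : ℝ}

theorem IsLpIdeal.eventually_sum_map_norm_rpow_le (h : IsLpIdeal p 𝓘 N q γ) (hp : 0 < p) (L : 𝓘) :
    ∀ᶠ F : 𝓘 in finiteRankNhds N L,
      ((nonzeroEigenvalues (F : X →L[ℂ] X)).map (‖·‖ ^ p)).sum ≤
        |γ| ^ p * (q * (1 + N L)) ^ p := by
  have hN := h.quasiNorm
  filter_upwards [eventually_isFiniteRank N L,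
    (tendsto_sub_finiteRankNhds hN L).eventually_le_const one_pos] with F hF hFL
  rw [← toReal_eigenvalueSum hp hF]
  refine (h.toReal_eigenvalueSum_le hp F).trans ?_
  have hNF := hN.nonneg F
  have hNF' := hN.le_of_sub_le_one hFL
  gcongr

theorem IsLpIdeal.exists_eventually_norm_prod_small_le (h : IsLpIdeal p 𝓘 N q γ) (hp : 0 < p)
    (hΓ : IsGrowthConstant X p Γ) (L : 𝓘) {ε : ℝ} (hε : 0 < ε) :
    ∃ ρ > 0, ∀ᶠ F : 𝓘 in finiteRankNhds N L,
      ‖(((nonzeroEigenvalues (F : X →L[ℂ] X)).filter fun μ => ¬ ρ ≤ ‖μ‖).map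
        (weierstrassFactor ⌈p⌉₊)).prod‖ ≤ Real.exp ε := by
  have hsum : ∀ ρ : ℝ, ∀ᶠ F : 𝓘 in finiteRankNhds N L,
      (((nonzeroEigenvalues (F : X →L[ℂ] X)).filter fun μ => ¬ ρ ≤ ‖μ‖).map (‖·‖ ^ p)).sum ≤
        |γ| ^ p * (q * (1 + N L)) ^ p := fun ρ =>
    (h.eventually_sum_map_norm_rpow_le hp L).mono fun F hF =>
      (sum_map_norm_rpow_le_of_le p (Multiset.filter_le _ _)).trans hF
  have hsmall : ∀ (s : Multiset ℂ) (ρ : ℝ), ∀ μ ∈ s.filter fun μ => ¬ ρ ≤ ‖μ‖, ‖μ‖ ≤ ρ :=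
    fun s ρ μ hμ => (not_le.1 (Multiset.mem_filter.1 hμ).2).le
  have hm : 1 ≤ ⌈p⌉₊ := Nat.one_le_ceil_iff.2 hp
  rcases (Nat.le_ceil p).lt_or_eq with hpm | hpm
  · obtain ⟨ρ, hρ, hprod⟩ := exists_forall_norm_prod_weierstrassFactor_le hp hpm
      (|γ| ^ p * (q * (1 + N L)) ^ p) hε
    exact ⟨ρ, hρ, (hsum ρ).mono fun F hF => hprod _ (hsmall _ ρ) hF⟩
  · have hpm' : p < ((⌈p⌉₊ + 1 : ℕ) : ℝ) := by
      rw [Nat.cast_succ, ← hpm]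
      exact lt_add_one p
    obtain ⟨ρ₁, hρ₁, hprod⟩ := exists_forall_norm_prod_weierstrassFactor_le hp hpm'
      (|γ| ^ p * (q * (1 + N L)) ^ p) (half_pos hε)
    obtain ⟨ρ, hρ, hρρ₁, hpow⟩ :=
      h.exists_eventually_norm_sum_small_pow_le hp hΓ hpm.symm L (half_pos hε) hρ₁
    refine ⟨ρ, hρ, ?_⟩
    filter_upwards [hsum ρ, hpow] with F hF hFpow
    have hFprod := hprod _ (fun μ hμ => (hsmall _ ρ μ hμ).trans hρρ₁) hF
    refine (norm_prod_map_weierstrassFactor_le hm _).trans ?_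
    rw [← add_halves ε, Real.exp_add]
    gcongr

end Tail

section Bound

open Filter

variable {X : Type u} [NormedAddCommGroup X] [NormedSpace ℂ X] [CompleteSpace X]
  {𝓘 : Submodule ℂ (X →L[ℂ] X)} {N : 𝓘 → ℝ} {p q γ Γ : ℝ} {D : 𝓘 → ℂ}

namespace IsLpIdeal

theorem norm_le_exp_eigenvalueSum_add (h : IsLpIdeal p 𝓘 N q γ) (hp : 0 < p)
    (hΓ : IsGrowthConstant X p Γ) (hD : IsContinuousDetExtension p 𝓘 N D) (L : 𝓘) {ε : ℝ}
    (hε : 0 < ε) :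
    ‖D L‖ ≤ Real.exp (Γ * ((eigenvalueSum p (L : X →L[ℂ] X)).toReal + ε) + ε) := by
  have hΓ0 := hΓ.1
  have := h.neBot_finiteRankNhds L
  obtain ⟨ρ, hρ, hsmall⟩ := h.exists_eventually_norm_prod_small_le hp hΓ L hε
  have hlarge := (h.tendsto_coe_finiteRankNhds L).eventually
    (eventually_sum_filter_le_toReal_eigenvalueSum_add hp (h.isCompactOperator L)
      (h.eigenvalueSum_ne_top hp L) hρ hε)
  refine le_of_tendsto (hD.tendsto_regDet L).norm ?_
  filter_upwards [eventually_isFiniteRank N L, hsmall, hlarge] with F hF hFsmall hFlarge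
  have hsplit := Multiset.filter_add_not (fun μ : ℂ => ρ ≤ ‖μ‖) (nonzeroEigenvalues (F : X →L[ℂ] X))
  rw [regDet_eq_prod p hF, ← hsplit, Multiset.map_add, Multiset.prod_add, norm_mul, Real.exp_add]
  gcongr
  refine (hΓ.norm_prod_le hp hF (Multiset.filter_le _ _)).trans (Real.exp_le_exp.2 ?_)
  exact mul_le_mul_of_nonneg_left (hFlarge hF) hΓ0.le

theorem norm_le_exp_eigenvalueSum (h : IsLpIdeal p 𝓘 N q γ) (hp : 0 < p)
    (hΓ : IsGrowthConstant X p Γ) (hD : IsContinuousDetExtension p 𝓘 N D) (L : 𝓘) :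
    ‖D L‖ ≤ Real.exp (Γ * (eigenvalueSum p (L : X →L[ℂ] X)).toReal) := by
  have hcont : Continuous fun ε : ℝ =>
      Real.exp (Γ * ((eigenvalueSum p (L : X →L[ℂ] X)).toReal + ε) + ε) := by fun_prop
  have hlim := (hcont.tendsto 0).mono_left (nhdsWithin_le_nhds (s := Set.Ioi 0))
  simp only [add_zero] at hlim
  exact ge_of_tendsto hlim (eventually_mem_nhdsWithin.mono fun ε hε =>
    h.norm_le_exp_eigenvalueSum_add hp hΓ hD L hε)

theorem hasExpBound (h : IsLpIdeal p 𝓘 N q γ) (hp : 0 < p) (hΓ : IsGrowthConstant X p Γ)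
    (hD : IsContinuousDetExtension p 𝓘 N D) : HasExpBound N p (|γ| ^ p * Γ) Set.univ D :=
  h.hasExpBound_of_le_exp_eigenvalueSum hp hΓ.1.le fun L _ =>
    h.norm_le_exp_eigenvalueSum hp hΓ hD L

-- A projection of rank one has the eigenvalue `1`.
theorem eigenvalueConstant_pos [Nontrivial X] (h : IsLpIdeal p 𝓘 N q γ) (hp : 0 < p) : 0 < γ := by
  by_contra! hγ
  obtain ⟨x, hx⟩ := exists_ne (0 : X)
  obtain ⟨G, hG, hG1⟩ := exists_isFiniteRank_nonzeroEigenvalues_eq (ℂ ∙ x) (t := {1}) (by simp)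
    (by rw [finrank_span_singleton hx, Multiset.card_singleton])
  have hle := h.eigenvalueSum_le hp ⟨G, h.finiteRank_mem G hG⟩
  rw [ENNReal.ofReal_of_nonpos (mul_nonpos_of_nonpos_of_nonneg hγ (h.quasiNorm.nonneg _)),
    ENNReal.zero_rpow_of_pos hp, nonpos_iff_eq_zero] at hle
  have hsum := toReal_eigenvalueSum hp hG
  simp [hle, hG1] at hsum

theorem abs_eq_self_or_subsingleton (h : IsLpIdeal p 𝓘 N q γ) (hp : 0 < p) :
    |γ| = γ ∨ Subsingleton 𝓘 := by
  cases subsingleton_or_nontrivial X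
  · exact .inr inferInstance
  · exact .inl (abs_of_pos (h.eigenvalueConstant_pos hp))

theorem norm_le_exp (h : IsLpIdeal p 𝓘 N q γ) (hp : 0 < p) (hΓ : IsGrowthConstant X p Γ)
    (hD : IsContinuousDetExtension p 𝓘 N D) (L : 𝓘) :
    ‖D L‖ ≤ Real.exp (γ ^ p * Γ * N L ^ p) := by
  have hbound := h.hasExpBound hp hΓ hD L (Set.mem_univ L)
  rcases h.abs_eq_self_or_subsingleton hp with hγ | hsub
  · rwa [hγ] at hbound
  · simpa [Subsingleton.elim L 0, h.quasiNorm.map_zero, Real.zero_rpow hp.ne'] using hbound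

theorem norm_sub_le (h : IsLpIdeal p 𝓘 N q γ) (hp : 0 < p) (hΓ : IsGrowthConstant X p Γ)
    (hD : IsContinuousDetExtension p 𝓘 N D) (K L : 𝓘) :
    ‖D K - D L‖ ≤ N (K - L) * Real.exp (q ^ (2 * p) * γ ^ p * Γ * (N K + N L + 1) ^ p) := by
  rcases h.abs_eq_self_or_subsingleton hp with hγ | hsub
  · have hΓ0 := hΓ.1
    have hdiff := IsEntireAlongLines.norm_sub_le h.quasiNorm (S := ⊤) hp (c := |γ| ^ p * Γ)
      (by positivity) (hD.isEntireAlongLines h hp hΓ) (h.hasExpBound hp hΓ hD)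
      (Submodule.mem_top (x := K)) (Submodule.mem_top (x := L))
    rwa [hγ, ← mul_assoc] at hdiff
  · simp [Subsingleton.elim K L, h.quasiNorm.map_zero]

end IsLpIdeal

end Bound

theorem theorem4p3 (p : ℝ) (hp : 0 < p) :
    (∃ Γ : ℝ, ∀ (X : Type u) [NormedAddCommGroup X] [NormedSpace ℂ X] [CompleteSpace X],
      IsGrowthConstant X p Γ) ∧
    ∀ (X : Type u) [NormedAddCommGroup X] [NormedSpace ℂ X] [CompleteSpace X]
      (𝓘 : Submodule ℂ (X →L[ℂ] X)) (N : 𝓘 → ℝ) (q γ : ℝ), IsLpIdeal p 𝓘 N q γ →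
      (∃! D : 𝓘 → ℂ, IsContinuousDetExtension p 𝓘 N D) ∧
      ∀ D : 𝓘 → ℂ, IsContinuousDetExtension p 𝓘 N D →
        ∀ Γ : ℝ, IsGrowthConstant X p Γ →
          (∀ L : 𝓘, ‖D L‖ ≤ Real.exp (γ ^ p * Γ * N L ^ p)) ∧
          (∀ K L : 𝓘, ‖D K - D L‖ ≤
            N (K - L) * Real.exp (q ^ (2 * p) * γ ^ p * Γ * (N K + N L + 1) ^ p)) := by
  obtain ⟨Γ₀, hΓ₀, hfactor⟩ := exists_norm_weierstrassFactor_le hp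
  refine ⟨⟨Γ₀, fun X _ _ _ => isGrowthConstant_of_norm_weierstrassFactor_le hp hΓ₀ hfactor⟩,
    fun X _ _ _ 𝓘 N q γ h => ⟨?_, fun D hD Γ hΓ => ⟨?_, ?_⟩⟩⟩
  · exact h.existsUnique_isContinuousDetExtension hp
      (isGrowthConstant_of_norm_weierstrassFactor_le hp hΓ₀ hfactor)
  · exact h.norm_le_exp hp hΓ hD
  · exact h.norm_sub_le hp hΓ hD
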